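/- Let $G$ be a finite abelian group, written additively. A sequence over $G$ is a finite sequence of nonzero elements of $G$ (repetitions allowed; formally, a finite set $S$ of pairs $(g,n)$ with $g\in G\setminus\{0\}$ and a label $n\in\mathbb{Z}_{\ge 0}$). It is zero-sum free if no nonempty subsequence has sum $0$, and its cross number is $\mathsf{k}(S)=\sum_{(g,n)\in S}\frac{1}{\operatorname{ord}(g)}$. Let $$\mathsf{k}(G)=\max\{\mathsf{k}(S): S \text{ is a zero-sum free sequence over } G\},$$ and, writing $G\cong\bigoplus_{i=1}^{m}C_{p_i^{\alpha_i}}$ as a direct sum of cyclic groups of prime power order (the $p_i$ not necessarily distinct), let $$\mathsf{k}^*(G)=\sum_{i=1}^{m}\Bigl(1-\frac{1}{p_i^{\alpha_i}}\Bigr).$$ A prime $p$ is wide with respect to a positive integer $n=q_1^{\beta_1}\cdots q_r^{\beta_r}$ (prime factorization), written $p\prec n$, if $p\nmid n$ and $$\frac{p}{p-1}\ \ge\ \prod_{j=1}^{r}\frac{q_j^{\beta_j+1}-1}{q_j^{\beta_j+1}-q_j^{\beta_j}}.$$ A positive integer $n=q_1^{\beta_1}\cdots q_r^{\beta_r}$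 with primes $q_1<\dots<q_r$ is wide if $q_i\prec\prod_{j=i+1}^{r}q_j^{\beta_j}$ for every $1\le i\le r-1$. Suppose that $\exp(G)$ is wide and that, for every prime $p$ other than the largest prime divisor of $\exp(G)$, the $p$-component of $G$ is cyclic. (Equivalently, if $q_1<\dots<q_r$ are the primes dividing $\exp(G)$, then $G\cong C_{q_1^{\beta_1}}\oplus\cdots\oplus C_{q_{r-1}^{\beta_{r-1}}}\oplus H$ with $H$ an arbitrary finite abelian $q_r$-group.) Then $\mathsf{k}(G)=\mathsf{k}^*(G)$. -/

import Mathlib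

/-- Squarefree indexed sequences over `G`: finite sets of pairs `(g, n)` with `g` a nonzero
element of `G` and `n : ℕ` a label. Subsequences are subsets, and the sequence `1` is `∅`. -/
abbrev IndexedSeq (G : Type*) [AddCommGroup G] : Type _ :=
  Finset ({g : G // g ≠ 0} × ℕ)

namespace IndexedSeq

variable {G : Type*} [AddCommGroup G]

/-- The sum of an indexed sequence. -/
def sum (S : IndexedSeq G) : G := ∑ x ∈ S, (x.1 : G)

/-- No nonempty subsequence has sum zero. -/
def IsZeroSumFree (S : IndexedSeq G) : Prop :=
  ∀ T : IndexedSeq G, T ⊆ S → T ≠ ∅ → sum T ≠ 0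

/-- The cross number of an indexed sequence: the sum of the inverse orders of its terms. -/
noncomputable def crossNumber (S : IndexedSeq G) : ℚ := ∑ x ∈ S, 1 / (addOrderOf (x.1 : G) : ℚ)

end IndexedSeq

/-- `c` is the little cross number `k(G)`, i.e. the maximum of the cross numbers of the
zero-sum free indexed sequences over `G`. -/
def IsLittleCrossNumber (G : Type*) [AddCommGroup G] (c : ℚ) : Prop :=
  IsGreatest {q : ℚ | ∃ S : IndexedSeq G, S.IsZeroSumFree ∧ S.crossNumber = q} c

/-- The value `k*(G)` for `G` a finite direct sum of cyclic groups of prime power orders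
`p i ^ a i`. -/
def kStar {ι : Type*} [Fintype ι] (p a : ι → ℕ) : ℚ := ∑ i, (1 - 1 / (p i : ℚ) ^ a i)

/-- The prime `p` is wide with respect to the positive integer `n` (written `p ≺ n`). -/
def PrimeWide (p n : ℕ) : Prop :=
  ¬ p ∣ n ∧
    ∏ q ∈ n.primeFactors,
        ((q : ℚ) ^ (n.factorization q + 1) - 1) /
          ((q : ℚ) ^ (n.factorization q + 1) - (q : ℚ) ^ n.factorization q)
      ≤ (p : ℚ) / ((p : ℚ) - 1)

/-- The largest prime dividing `n` (and `0` if there is none). -/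
def largestPrimeFactor (n : ℕ) : ℕ := n.primeFactors.sup id

/-- The positive integer `n` is wide: each prime divisor `q` of `n` other than the largest one
is wide with respect to the part of `n` composed of the primes greater than `q`. -/
def Wide (n : ℕ) : Prop :=
  ∀ q ∈ n.primeFactors, q ≠ largestPrimeFactor n →
    PrimeWide q (∏ q' ∈ n.primeFactors with q < q', q' ^ n.factorization q')

set_option linter.unusedSectionVars false

/-! The value `k*(G)` is attained by repeating each basis element one time less than its order. For
the upper bound the primary components are added one prime at a time, from the largest downwards
(`crossBound_part`).

The component of the largest prime `q` is an arbitrary abelian `q`-group, treated in its group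
algebra over `ZMod q`. For a zero-sum free family the product of the elements `X^g - 1` is nonzero.
Each factor lies in an ideal spanned by monomials whose weight is at least a constant times `1 / ord
g`, and monomials of too large weight vanish (`crossBound_pi_zmod_pow`).

Now let a cyclic `p`-group `C` be added to a group `G` whose element orders involve only primes
above `p`. It must be shown that the bound grows by at most `m = 1 - 1 / p ^ α`
(`ZeroSumFree.crossNum_prod_le`). In a counterexample with fewest terms, replacing several terms by
their sum strictly lowers the cross number. Give a term `(g, c)` the weight `1 / ord c`, and let `β
d` be the total weight of the terms with `c ≠ 0` and `ord g = d`. Minimality forces `β d ≤ m` for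
all `d`. Moreover either the `p`-torsion of `C` can be factored out, lowering `α`, or `β 1 ≤ m - 1 /
p`. Replacing the terms with `c ≠ 0` by sums of disjoint subfamilies whose `C`-components cancel
leaves a zero-sum free family over `G`. So it suffices that this replacement can be done at cost at
most `m` (`ZeroSumFree.crossNum_le_of_costLE`, `Packable`).

Costs are controlled by two facts: a minimal zero-sum family in `C` has weight at most `1`, and a
zero-sum free one has weight at most `m`. Along a chain `D 0 ∣ D 1 ∣ ⋯` of orders the leftovers are
passed on, and the total cost is `m / D 0` plus the cost of rounding orders up to the chain
(`costLE_chain`). Let `q` be the next prime and `n'` the part of the exponent above `q`. The orders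
split into lines `c, c * q, c * q ^ 2, …` with `c ∣ n'`. Each costs at most `m / c`, and the line of
`1` saves `(1 / p) * (1 - 1 / q)`. Wideness at `q` bounds the sum of `1 / c` by `q / (q - 1)`, which
suffices unless `q = p + 1`, that is, `p = 2` and `q = 3`. There wideness at `2` is used as well,
and lines are merged according to which sums `β 1 + β c` exceed `m` (`packable_two_three`). -/

namespace CrossNumber

open Finset

/-- A finite family in an abelian group is zero-sum free if no nonempty subfamily has sum `0`. -/
def ZeroSumFree {ι G : Type*} [AddCommGroup G] (s : Finset ι) (f : ι → G) : Prop :=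
  ∀ t ⊆ s, t.Nonempty → ∑ i ∈ t, f i ≠ 0

/-- The cross number of a finite family. -/
noncomputable def crossNum {ι G : Type*} [AddCommGroup G] (s : Finset ι) (f : ι → G) : ℚ :=
  ∑ i ∈ s, 1 / (addOrderOf (f i) : ℚ)

/-- All zero-sum free families over `G` have cross number at most `c`. -/
def CrossBound.{u, v} (G : Type v) [AddCommGroup G] (c : ℚ) : Prop :=
  ∀ (ι : Type u) (s : Finset ι) (f : ι → G), ZeroSumFree s f → crossNum s f ≤ c

/-! ### Zero-sum free families, amalgamation and subset sums -/

section Basic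

variable {ι G C : Type*} [AddCommGroup G] [AddCommGroup C] {s t : Finset ι} {f : ι → G}

theorem ZeroSumFree.mono (h : ZeroSumFree s f) (ht : t ⊆ s) : ZeroSumFree t f :=
  fun u hu hne => h u (hu.trans ht) hne

theorem ZeroSumFree.ne_zero (h : ZeroSumFree s f) {i : ι} (hi : i ∈ s) : f i ≠ 0 := by
  simpa using h {i} (by simpa using hi) (by simp)

theorem exists_minimal_zero_sum (h : ¬ ZeroSumFree s f) :
    ∃ t ⊆ s, t.Nonempty ∧ ∑ i ∈ t, f i = 0 ∧ ∀ u ⊂ t, u.Nonempty → ∑ i ∈ u, f i ≠ 0 := by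
  classical
  have hex : (s.powerset.filter fun t => t.Nonempty ∧ ∑ i ∈ t, f i = 0).Nonempty := by
    simp only [ZeroSumFree, not_forall, ne_eq, not_not] at h
    obtain ⟨t, ht, hne, h0⟩ := h
    exact ⟨t, by simp [ht, hne, h0]⟩
  obtain ⟨t, ht⟩ := exists_minimal hex
  obtain ⟨hts, hne, h0⟩ : t ⊆ s ∧ t.Nonempty ∧ ∑ i ∈ t, f i = 0 := by simpa using ht.1
  refine ⟨t, hts, hne, h0, fun u hu hune hu0 => hu.2 (ht.2 (y := u) ?_ hu.subset)⟩
  simp [hu.subset.trans hts, hune, hu0]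

theorem ZeroSumFree.map {H : Type*} [AddCommGroup H] (h : ZeroSumFree s f) (φ : G →+ H)
    (hφ : Function.Injective φ) : ZeroSumFree s (fun i => φ (f i)) := by
  intro t ht hne h0
  rw [← map_sum] at h0
  exact h t ht hne ((map_eq_zero_iff φ hφ).1 h0)

theorem CrossBound.of_injective.{u, v, w} {G : Type v} {H : Type w} [AddCommGroup G]
    [AddCommGroup H] {c : ℚ} (h : CrossBound.{u} H c) (φ : G →+ H)
    (hφ : Function.Injective φ) : CrossBound.{u} G c := by
  intro ι s f hf
  have h1 := h ι s _ (hf.map φ hφ)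
  simpa [crossNum, addOrderOf_injective φ hφ] using h1

theorem crossNum_sdiff_add [DecidableEq ι] (h : t ⊆ s) :
    crossNum (s \ t) f + crossNum t f = crossNum s f := sum_sdiff h

/-- Replacing a subfamily by its sum preserves zero-sum freeness. -/
theorem ZeroSumFree.amalgamate [DecidableEq ι] (h : ZeroSumFree s f) (ht : t ⊆ s) {i₀ : ι}
    (hi : i₀ ∈ t) :
    ZeroSumFree (insert i₀ (s \ t)) (Function.update f i₀ (∑ i ∈ t, f i)) := by
  intro u hu hne h0
  have hsub : u.erase i₀ ⊆ s \ t := by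
    intro i hi'
    have := hu (mem_of_mem_erase hi')
    rcases mem_insert.1 this with h1 | h1
    · exact absurd h1 (ne_of_mem_erase hi')
    · exact h1
  have hsum : ∑ i ∈ u.erase i₀, Function.update f i₀ (∑ i ∈ t, f i) i
      = ∑ i ∈ u.erase i₀, f i :=
    sum_congr rfl fun i hi' => Function.update_of_ne (ne_of_mem_erase hi') _ _
  by_cases hiu : i₀ ∈ u
  · rw [← add_sum_erase _ _ hiu, hsum, Function.update_self] at h0
    have hd : Disjoint t (u.erase i₀) :=
      disjoint_left.2 fun i hit hiu' => (mem_sdiff.1 (hsub hiu')).2 hit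
    rw [← sum_union hd] at h0
    exact h _ (union_subset ht (hsub.trans sdiff_subset)) ⟨i₀, mem_union_left _ hi⟩ h0
  · rw [erase_eq_of_notMem hiu] at hsum hsub
    rw [hsum] at h0
    exact h _ (hsub.trans sdiff_subset) hne h0

theorem sum_amalgamate [DecidableEq ι] {M : Type*} [AddCommMonoid M] {i₀ : ι}
    (hi : i₀ ∈ t) (F : G → M) (x : G) :
    ∑ i ∈ insert i₀ (s \ t), F (Function.update f i₀ x i) = F x + ∑ i ∈ s \ t, F (f i) := by
  have hn : i₀ ∉ s \ t := fun h => (mem_sdiff.1 h).2 hi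
  rw [sum_insert hn, Function.update_self]
  congr 1
  exact sum_congr rfl fun i hi' => by
    have hne : i ≠ i₀ := fun h => hn (by rwa [← h])
    rw [Function.update_of_ne hne]

theorem card_amalgamate [DecidableEq ι] (ht : t ⊆ s) {i₀ : ι} (hi : i₀ ∈ t) :
    #(insert i₀ (s \ t)) + #t = #s + 1 := by
  have hn : i₀ ∉ s \ t := fun h => (mem_sdiff.1 h).2 hi
  rw [card_insert_of_notMem hn]
  have := card_sdiff_add_card_eq_card ht
  omega

/-- Each new term enlarges the set `P` of subset sums. Otherwise `P` would be invariant under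
translation by `f a`, and `0 ∈ P` would yield a subset sum equal to `-f a`. -/
theorem ZeroSumFree.card_lt_card_sums [DecidableEq G] (h : ZeroSumFree s f) :
    #s < #(s.powerset.image fun t => ∑ i ∈ t, f i) := by
  classical
  induction s using Finset.induction_on with
  | empty => simp
  | insert a s ha ih =>
    have ih := ih (h.mono (subset_insert _ _))
    set P := s.powerset.image fun t => ∑ i ∈ t, f i with hP
    set Q := (insert a s).powerset.image fun t => ∑ i ∈ t, f i with hQ
    have hPQ : P ⊆ Q := image_subset_image (powerset_mono.2 (subset_insert _ _))
    have hPaQ : P.image (· + f a) ⊆ Q := by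
      intro x hx
      obtain ⟨y, hy, rfl⟩ := mem_image.1 hx
      obtain ⟨t, ht, rfl⟩ := mem_image.1 hy
      have hat : a ∉ t := fun h' => ha (mem_powerset.1 ht h')
      refine mem_image.2 ⟨insert a t, mem_powerset.2 (insert_subset_insert _ (mem_powerset.1 ht)), ?_⟩
      rw [sum_insert hat, add_comm]
    have hne : P ≠ Q := by
      intro heq
      have hsub : P.image (· + f a) ⊆ P := heq ▸ hPaQ
      have hcard : #(P.image (· + f a)) = #P := card_image_of_injective _ (add_left_injective _)
      have heq' := eq_of_subset_of_card_le hsub hcard.ge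
      have h0 : (0 : G) ∈ P := mem_image.2 ⟨∅, by simp, by simp⟩
      rw [← heq'] at h0
      obtain ⟨y, hy, hy0⟩ := mem_image.1 h0
      obtain ⟨t, ht, rfl⟩ := mem_image.1 hy
      have hat : a ∉ t := fun h' => ha (mem_powerset.1 ht h')
      refine h (insert a t) (insert_subset_insert _ (mem_powerset.1 ht)) (insert_nonempty _ _) ?_
      rw [sum_insert hat, add_comm]
      exact hy0
    have := card_lt_card (hPQ.ssubset_of_ne hne)
    rw [card_insert_of_notMem ha]
    omega

end Basic

/-! ### Cross numbers in cyclic `p`-groups -/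

/-- The subgroup of elements killed by `p` has at most `p` elements. -/
def SmallTorsion (C : Type*) [AddCommGroup C] (p : ℕ) : Prop :=
  ∀ F : Finset C, (∀ x ∈ F, p • x = 0) → #F ≤ p

section Torsion

variable {ι C : Type*} [AddCommGroup C] {p : ℕ} {s : Finset ι} {c : ι → C}

theorem ZeroSumFree.card_lt_of_torsion (hC : SmallTorsion C p) (h : ZeroSumFree s c)
    (hs : ∀ i ∈ s, p • c i = 0) : #s < p := by
  classical
  refine h.card_lt_card_sums.trans_le (hC _ ?_)
  intro x hx
  obtain ⟨t, ht, rfl⟩ := mem_image.1 hx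
  rw [smul_sum]
  exact sum_eq_zero fun i hi => hs i (mem_powerset.1 ht hi)

/-- With `p - 1` terms there are at least `p` subset sums, so they exhaust the `p`-torsion. -/
theorem ZeroSumFree.exists_sum_eq_of_torsion (hC : SmallTorsion C p) (h : ZeroSumFree s c)
    (hs : ∀ i ∈ s, p • c i = 0) (hcard : p ≤ #s + 1) {x : C} (hx : p • x = 0) :
    ∃ t ⊆ s, ∑ i ∈ t, c i = x := by
  classical
  by_contra hcon
  have hx' : x ∉ s.powerset.image fun t => ∑ i ∈ t, c i := by
    intro h'
    obtain ⟨t, ht, rfl⟩ := mem_image.1 h'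
    exact hcon ⟨t, mem_powerset.1 ht, rfl⟩
  have h1 := hC (insert x (s.powerset.image fun t => ∑ i ∈ t, c i)) (by
    intro y hy
    rcases mem_insert.1 hy with rfl | hy
    · exact hx
    · obtain ⟨t, ht, rfl⟩ := mem_image.1 hy
      rw [smul_sum]
      exact sum_eq_zero fun i hi => hs i (mem_powerset.1 ht hi))
  rw [card_insert_of_notMem hx'] at h1
  have := h.card_lt_card_sums
  omega

/-- Multiplication by `p ^ j` moves the terms into the `p`-torsion, where `p` terms cannot be
zero-sum free. -/
theorem exists_subset_torsion_sum (hC : SmallTorsion C p) {j : ℕ} (hcard : p ≤ #s)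
    (hs : ∀ i ∈ s, p ^ (j + 1) • c i = 0) :
    ∃ t ⊆ s, t.Nonempty ∧ #t ≤ p ∧ p ^ j • ∑ i ∈ t, c i = 0 := by
  obtain ⟨u, hu, hup⟩ := exists_subset_card_eq hcard
  have hnot : ¬ ZeroSumFree u (fun i => p ^ j • c i) := by
    intro h
    have := h.card_lt_of_torsion hC (fun i hi => by
      rw [smul_smul, ← pow_succ']
      exact hs i (hu hi))
    omega
  simp only [ZeroSumFree, not_forall, ne_eq, not_not] at hnot
  obtain ⟨t, ht, hne, h0⟩ := hnot
  exact ⟨t, ht.trans hu, hne, (card_le_card ht).trans hup.le, by rw [smul_sum, h0]⟩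

theorem addOrderOf_of_torsion (hp : p.Prime) {j : ℕ} {x : C} (h : p ^ (j + 1) • x = 0)
    (h' : p ^ j • x ≠ 0) : addOrderOf x = p ^ (j + 1) := by
  have := Fact.mk hp
  exact addOrderOf_eq_prime_pow h' h

theorem one_div_addOrderOf_ge {G : Type*} [AddCommGroup G] {D : ℕ} (hD : 0 < D) {x : G}
    (h : D • x = 0) : 1 / (D : ℚ) ≤ 1 / (addOrderOf x : ℚ) := by
  have hd : addOrderOf x ∣ D := addOrderOf_dvd_iff_nsmul_eq_zero.2 h
  have hpos : 0 < addOrderOf x := Nat.pos_of_dvd_of_pos hd hD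
  exact one_div_le_one_div_of_le (by exact_mod_cast hpos) (by exact_mod_cast Nat.le_of_dvd hD hd)

/-- Zero-sum free families in the `p ^ α`-torsion of a cyclic `p`-group have cross number at most
`1 - 1 / p ^ α`. -/
theorem ZeroSumFree.crossNum_le_of_torsion (hp : p.Prime) (hC : SmallTorsion C p) (α : ℕ) :
    ∀ {s : Finset ι} {c : ι → C}, ZeroSumFree s c → (∀ i ∈ s, p ^ α • c i = 0) →
      crossNum s c ≤ 1 - 1 / (p : ℚ) ^ α := by
  classical
  have hp0 : (0 : ℚ) < p := by exact_mod_cast hp.pos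
  induction α with
  | zero =>
    intro s c h hs
    have : s = ∅ := by
      by_contra hne
      obtain ⟨i, hi⟩ := nonempty_iff_ne_empty.2 hne
      exact h.ne_zero hi (by simpa using hs i hi)
    simp [this, crossNum]
  | succ α ih =>
    intro s
    induction hn : #s using Nat.strong_induction_on generalizing s with
    | _ n ihn =>
    intro c h hs
    set U := s.filter fun i => p ^ α • c i ≠ 0 with hU
    have hUord : ∀ i ∈ U, addOrderOf (c i) = p ^ (α + 1) := fun i hi =>
      addOrderOf_of_torsion hp (hs i (mem_filter.1 hi).1) (mem_filter.1 hi).2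
    -- Among `p` terms of the top order `p ^ (α + 1)`, at most `p` can be amalgamated into a term of
    -- order dividing `p ^ α`. This does not lower the cross number, so induction on the number of
    -- terms applies. With at most `p - 1` of them, their share is at most `(p - 1) / p ^ (α + 1)`
    -- and the rest is covered by `α`.
    by_cases hcard : p ≤ #U
    · obtain ⟨t, ht, ⟨i₀, hi₀⟩, htp, ht0⟩ := exists_subset_torsion_sum hC hcard
        (fun i hi => hs i (mem_filter.1 hi).1)
      have hts : t ⊆ s := ht.trans (filter_subset _ _)
      have ht2 : 2 ≤ #t := by
        by_contra hlt
        have h1 : #t = 1 := by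
          have : 0 < #t := card_pos.2 ⟨i₀, hi₀⟩
          omega
        obtain ⟨i, rfl⟩ := card_eq_one.1 h1
        rw [sum_singleton] at ht0
        exact (mem_filter.1 (ht (mem_singleton_self i))).2 ht0
      have hca := card_amalgamate hts hi₀
      have hle := ihn _ (by omega) rfl (h.amalgamate hts hi₀) (by
        intro i hi
        rcases mem_insert.1 hi with rfl | hi'
        · rw [Function.update_self, pow_succ', mul_smul, ht0, smul_zero]
        · have hne : i ≠ i₀ := fun h' => (mem_sdiff.1 hi').2 (h' ▸ hi₀)
          rw [Function.update_of_ne hne]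
          exact hs i (mem_sdiff.1 hi').1)
      unfold crossNum at hle
      rw [sum_amalgamate hi₀ (fun x => 1 / (addOrderOf x : ℚ))] at hle
      have h1 := one_div_addOrderOf_ge (pow_pos hp.pos α) ht0
      have h2 : crossNum t c ≤ 1 / (p : ℚ) ^ α := by
        have : crossNum t c = #t * (1 / (p : ℚ) ^ (α + 1)) := by
          unfold crossNum
          rw [← nsmul_eq_mul]
          exact sum_eq_card_nsmul fun i hi => by rw [hUord i (ht hi)]; push_cast; rfl
        rw [this]
        calc (#t : ℚ) * (1 / (p : ℚ) ^ (α + 1)) ≤ p * (1 / (p : ℚ) ^ (α + 1)) := by gcongr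
          _ = 1 / (p : ℚ) ^ α := by rw [pow_succ']; field_simp
      have h3 := crossNum_sdiff_add (f := c) hts
      unfold crossNum at h2 h3 ⊢
      push_cast at h1
      linarith
    · have hsub : U ⊆ s := filter_subset _ _
      have h1 := crossNum_sdiff_add (f := c) hsub
      have h2 : crossNum (s \ U) c ≤ 1 - 1 / (p : ℚ) ^ α :=
        ih (h.mono sdiff_subset) (fun i hi => by
          have := mem_sdiff.1 hi
          by_contra hne
          exact this.2 (mem_filter.2 ⟨this.1, hne⟩))
      have h3 : crossNum U c ≤ ((p : ℚ) - 1) * (1 / (p : ℚ) ^ (α + 1)) := by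
        have : crossNum U c = #U * (1 / (p : ℚ) ^ (α + 1)) := by
          unfold crossNum
          rw [← nsmul_eq_mul]
          exact sum_eq_card_nsmul fun i hi => by rw [hUord i hi]; push_cast; rfl
        rw [this]
        gcongr
        have : #U + 1 ≤ p := by omega
        have : ((#U + 1 : ℕ) : ℚ) ≤ p := by exact_mod_cast this
        push_cast at this
        linarith
      have h4 : ((p : ℚ) - 1) * (1 / (p : ℚ) ^ (α + 1)) = 1 / (p : ℚ) ^ α - 1 / (p : ℚ) ^ (α + 1) := by
        rw [pow_succ']
        field_simp
      linarith

/-- A minimal zero-sum family in a cyclic `p`-group has cross number at most one. -/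
theorem crossNum_le_one_of_minimal (hp : p.Prime) (hC : SmallTorsion C p) {α : ℕ}
    {t : Finset ι} (hne : t.Nonempty) (ht : ∀ i ∈ t, p ^ α • c i = 0)
    (hmin : ∀ u ⊂ t, u.Nonempty → ∑ i ∈ u, c i ≠ 0) : crossNum t c ≤ 1 := by
  classical
  -- Removing a term of maximal order `p ^ k` leaves a zero-sum free family killed by `p ^ k`. Its
  -- bound `1 - 1 / p ^ k` and the removed `1 / p ^ k` add up to `1`.
  obtain ⟨x, hx, hmax⟩ := exists_max_image t (fun i => addOrderOf (c i)) hne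
  have hord : ∀ i ∈ t, ∃ k, addOrderOf (c i) = p ^ k := fun i hi => by
    obtain ⟨k, -, hk⟩ := (Nat.dvd_prime_pow hp).1 (addOrderOf_dvd_iff_nsmul_eq_zero.2 (ht i hi))
    exact ⟨k, hk⟩
  obtain ⟨k, hk⟩ := hord x hx
  have h1 : crossNum (t.erase x) c ≤ 1 - 1 / (p : ℚ) ^ k := by
    refine ZeroSumFree.crossNum_le_of_torsion hp hC k (fun u hu hu' => ?_) (fun i hi => ?_)
    · exact hmin u (hu.trans_ssubset (erase_ssubset hx)) hu'
    · obtain ⟨l, hl⟩ := hord i (mem_of_mem_erase hi)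
      rw [← addOrderOf_dvd_iff_nsmul_eq_zero, hl]
      have := hmax i (mem_of_mem_erase hi)
      rw [hl, hk] at this
      exact pow_dvd_pow p ((Nat.pow_le_pow_iff_right hp.one_lt).1 this)
  have h2 : crossNum t c = 1 / (addOrderOf (c x) : ℚ) + crossNum (t.erase x) c := by
    unfold crossNum
    rw [add_sum_erase _ (fun i => 1 / (addOrderOf (c i) : ℚ)) hx]
  rw [h2, hk]
  push_cast
  linarith

end Torsion

/-! ### Packings and their cost -/

section Packing

variable {ι G C : Type*} [AddCommGroup G] [AddCommGroup C]

/-- The inverse order of the second component of the `i`-th term. -/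
noncomputable def kap (f : ι → G × C) (i : ι) : ℚ := 1 / (addOrderOf (f i).2 : ℚ)

/-- A packing of `U`: disjoint nonempty subfamilies whose second components sum to zero. -/
def Packing (f : ι → G × C) (U : Finset ι) (𝒯 : Finset (Finset ι)) : Prop :=
  (∀ T ∈ 𝒯, T.Nonempty ∧ T ⊆ U ∧ ∑ i ∈ T, (f i).2 = 0) ∧ (𝒯 : Set (Finset ι)).PairwiseDisjoint id

/-- The cross number of the sums of the members of a packing. -/
noncomputable def gain (f : ι → G × C) (𝒯 : Finset (Finset ι)) : ℚ :=
  ∑ T ∈ 𝒯, 1 / (addOrderOf (∑ i ∈ T, (f i).1) : ℚ)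

/-- The family indexed by `U` loses at most `x` of its cross number when it is replaced by the
sums of the members of a suitable packing. -/
def CostLE (f : ι → G × C) (U : Finset ι) (x : ℚ) : Prop :=
  ∃ 𝒯, Packing f U 𝒯 ∧ ∑ i ∈ U, kap f i * (1 / (addOrderOf (f i).1 : ℚ)) ≤ gain f 𝒯 + x

variable {f : ι → G × C} {U W s : Finset ι} {𝒯 𝒯' : Finset (Finset ι)} {x y : ℚ}

theorem kap_nonneg (f : ι → G × C) (i : ι) : 0 ≤ kap f i := by
  unfold kap; positivity

theorem Packing.mono (h : Packing f U 𝒯) (hU : U ⊆ W) : Packing f W 𝒯 :=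
  ⟨fun T hT => ⟨(h.1 T hT).1, (h.1 T hT).2.1.trans hU, (h.1 T hT).2.2⟩, h.2⟩

theorem Packing.disjoint_of (h' : Packing f W 𝒯') (hd : ∀ T ∈ 𝒯, Disjoint T W) :
    Disjoint 𝒯 𝒯' := by
  refine disjoint_left.2 fun T hT hT' => ?_
  obtain ⟨⟨i, hi⟩, hsub, -⟩ := h'.1 T hT'
  exact disjoint_left.1 (hd T hT) hi (hsub hi)

theorem Packing.union [DecidableEq ι] (h : Packing f U 𝒯) (h' : Packing f W 𝒯')
    (hd : ∀ T ∈ 𝒯, Disjoint T W) : Packing f (U ∪ W) (𝒯 ∪ 𝒯') := by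
  refine ⟨fun T hT => ?_, ?_⟩
  · rcases mem_union.1 hT with hT | hT
    · exact (h.mono subset_union_left).1 T hT
    · exact (h'.mono subset_union_right).1 T hT
  · intro T hT T' hT' hne
    rcases mem_union.1 (mem_coe.1 hT) with hT | hT <;>
    rcases mem_union.1 (mem_coe.1 hT') with hT' | hT'
    · exact h.2 hT hT' hne
    · exact (hd T hT).mono_right (h'.1 T' hT').2.1
    · exact ((hd T' hT').mono_right (h'.1 T hT).2.1).symm
    · exact h'.2 hT hT' hne

theorem gain_union [DecidableEq ι] (h : Disjoint 𝒯 𝒯') :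
    gain f (𝒯 ∪ 𝒯') = gain f 𝒯 + gain f 𝒯' := sum_union h

theorem packing_empty (f : ι → G × C) (U : Finset ι) : Packing f U ∅ := by
  simp [Packing]

theorem CostLE.mono_right (h : CostLE f U x) (hxy : x ≤ y) : CostLE f U y := by
  obtain ⟨𝒯, h1, h2⟩ := h
  exact ⟨𝒯, h1, by linarith⟩

theorem costLE_trivial (f : ι → G × C) (U : Finset ι) :
    CostLE f U (∑ i ∈ U, kap f i * (1 / (addOrderOf (f i).1 : ℚ))) :=
  ⟨∅, packing_empty f U, by simp [gain]⟩

theorem CostLE.union [DecidableEq ι] (hU : CostLE f U x) (hW : CostLE f W y)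
    (hd : Disjoint U W) : CostLE f (U ∪ W) (x + y) := by
  obtain ⟨𝒯, h1, h2⟩ := hU
  obtain ⟨𝒯', h1', h2'⟩ := hW
  have hdT : ∀ T ∈ 𝒯, Disjoint T W := fun T hT => hd.mono_left (h1.1 T hT).2.1
  refine ⟨𝒯 ∪ 𝒯', h1.union h1' hdT, ?_⟩
  rw [gain_union (h1'.disjoint_of hdT), sum_union hd]
  linarith

theorem CostLE.biUnion [DecidableEq ι] {κ : Type*} [DecidableEq κ] (X : Finset κ)
    (V : κ → Finset ι) (y : κ → ℚ) (h : ∀ c ∈ X, CostLE f (V c) (y c))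
    (hd : (X : Set κ).PairwiseDisjoint V) : CostLE f (X.biUnion V) (∑ c ∈ X, y c) := by
  induction X using Finset.induction_on with
  | empty => simpa using costLE_trivial f ∅
  | insert a X ha ih =>
    rw [biUnion_insert, sum_insert ha]
    refine (h a (mem_insert_self _ _)).union (ih (fun c hc => h c (mem_insert_of_mem hc))
      (hd.subset (by simp))) ?_
    rw [disjoint_biUnion_right]
    intro c hc
    exact hd (by simp) (by simp [hc]) (by rintro rfl; exact ha hc)

variable {p α : ℕ}

theorem sum_kap_le (hp : p.Prime) (hC : SmallTorsion C p)
    (hα : ∀ i ∈ U, p ^ α • (f i).2 = 0) (h : ZeroSumFree U fun i => (f i).2) :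
    ∑ i ∈ U, kap f i ≤ 1 - 1 / (p : ℚ) ^ α :=
  h.crossNum_le_of_torsion hp hC α hα

/-- Exhaust a family by disjoint subfamilies with vanishing second component. -/
theorem exists_packing (hp : p.Prime) (hC : SmallTorsion C p) {D : ℕ} (hD : 0 < D) :
    ∀ {W : Finset ι}, (∀ i ∈ W, p ^ α • (f i).2 = 0) → (∀ i ∈ W, addOrderOf (f i).1 ∣ D) →
    ∃ 𝒯 L, Packing f W 𝒯 ∧ L ⊆ W ∧ (∀ T ∈ 𝒯, Disjoint T L) ∧
      ZeroSumFree L (fun i => (f i).2) ∧ ∑ i ∈ W, kap f i ≤ ∑ i ∈ L, kap f i + #𝒯 ∧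
      #𝒯 * (1 / (D : ℚ)) ≤ gain f 𝒯 := by
  classical
  intro W
  induction hn : #W using Nat.strong_induction_on generalizing W with
  | _ n ih =>
  intro hα hord
  by_cases hW : ZeroSumFree W fun i => (f i).2
  · exact ⟨∅, W, packing_empty f W, Subset.rfl, by simp, hW, by simp, by simp [gain]⟩
  -- A minimal `T` has weight at most `1`, so each extracted member removes at most one unit of
  -- weight. Its sum has order dividing `D` in the first component, which gains at least `1 / D`.
  obtain ⟨T, hTW, hTne, hT0, hmin⟩ := exists_minimal_zero_sum hW
  have hT1 : ∑ i ∈ T, kap f i ≤ 1 :=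
    crossNum_le_one_of_minimal (c := fun i => (f i).2) hp hC hTne (fun i hi => hα i (hTW hi)) hmin
  have hcard : #(W \ T) < n := by
    rw [← hn]
    exact card_lt_card (sdiff_ssubset hTW hTne)
  obtain ⟨𝒯, L, hP, hLW, hdL, hL, hk, hg⟩ := ih _ hcard rfl
    (fun i hi => hα i (mem_sdiff.1 hi).1) (fun i hi => hord i (mem_sdiff.1 hi).1)
  have hdT : Disjoint T (W \ T) := disjoint_sdiff
  have hPT : Packing f T {T} := by
    refine ⟨?_, by simp⟩
    intro T' hT'
    rw [mem_singleton.1 hT']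
    exact ⟨hTne, Subset.rfl, hT0⟩
  have hd' : ∀ T' ∈ ({T} : Finset (Finset ι)), Disjoint T' (W \ T) := by
    simpa using hdT
  have hdisj := hP.disjoint_of hd'
  refine ⟨{T} ∪ 𝒯, L, ?_, hLW.trans sdiff_subset, ?_, hL, ?_, ?_⟩
  · have := hPT.union hP hd'
    rwa [union_sdiff_of_subset hTW] at this
  · intro T' hT'
    rcases mem_union.1 hT' with h | h
    · rw [mem_singleton.1 h]
      exact hdT.mono_right hLW
    · exact hdL T' h
  · have h1 := sum_sdiff (f := kap f) hTW
    rw [card_union_of_disjoint hdisj, card_singleton]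
    push_cast
    linarith
  · rw [card_union_of_disjoint hdisj, card_singleton, gain_union hdisj]
    have : 1 / (D : ℚ) ≤ gain f {T} := by
      simp only [gain, sum_singleton]
      refine one_div_addOrderOf_ge hD ?_
      rw [smul_sum]
      exact sum_eq_zero fun i hi => addOrderOf_dvd_iff_nsmul_eq_zero.1 (hord i (hTW hi))
    push_cast
    linarith

/-- The leftover of stage `k` joins the terms of stage `k + 1`. Being zero-sum free it weighs at
most `1 - 1 / p ^ α`, so carrying it on loses at most that multiple of `1 / D k - 1 / D (k + 1)`,
and these losses telescope. -/
theorem exists_packing_chain (hp : p.Prime) (hC : SmallTorsion C p)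
    (hα : ∀ i ∈ U, p ^ α • (f i).2 = 0) {D : ℕ → ℕ} (hD : ∀ k, 0 < D k)
    (hDD : ∀ k, D k ∣ D (k + 1)) (st : ι → ℕ) (hord : ∀ i ∈ U, addOrderOf (f i).1 ∣ D (st i))
    (k : ℕ) :
    ∃ 𝒯 L, Packing f (U.filter fun i => st i ≤ k) 𝒯 ∧ L ⊆ (U.filter fun i => st i ≤ k) ∧
      (∀ T ∈ 𝒯, Disjoint T L) ∧ ZeroSumFree L (fun i => (f i).2) ∧
      ∑ i ∈ U with st i ≤ k, kap f i * (1 / (D (st i) : ℚ)) - (∑ i ∈ L, kap f i) * (1 / (D k : ℚ))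
        - (1 - 1 / (p : ℚ) ^ α) * (1 / (D 0 : ℚ) - 1 / (D k : ℚ)) ≤ gain f 𝒯 := by
  classical
  have hdvd : ∀ {i k}, i ≤ k → D i ∣ D k := by
    intro i k hik
    induction hik with
    | refl => rfl
    | step _ ih => exact ih.trans (hDD _)
  induction k with
  | zero =>
    obtain ⟨𝒯, L, hP, hLW, hdL, hL, hk, hg⟩ := exists_packing (f := f) hp hC (hD 0)
      (W := U.filter fun i => st i ≤ 0) (fun i hi => hα i (mem_filter.1 hi).1)
      (fun i hi => (hord i (mem_filter.1 hi).1).trans (hdvd (mem_filter.1 hi).2))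
    refine ⟨𝒯, L, hP, hLW, hdL, hL, ?_⟩
    have h1 : ∑ i ∈ U with st i ≤ 0, kap f i * (1 / (D (st i) : ℚ))
        = (∑ i ∈ U with st i ≤ 0, kap f i) * (1 / (D 0 : ℚ)) := by
      rw [sum_mul]
      exact sum_congr rfl fun i hi => by rw [Nat.le_zero.1 (mem_filter.1 hi).2]
    rw [h1]
    have h2 : 0 ≤ 1 / (D 0 : ℚ) := by positivity
    have := mul_le_mul_of_nonneg_right hk h2
    linarith
  | succ k ih =>
    obtain ⟨𝒯, L, hP, hLU, hdL, hL, hg⟩ := ih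
    set U₁ := U.filter fun i => st i = k + 1 with hU₁
    have hLU₁ : Disjoint L U₁ := by
      refine disjoint_left.2 fun i hi hi' => ?_
      have := (mem_filter.1 (hLU hi)).2
      have := (mem_filter.1 hi').2
      omega
    have hsplit : (U.filter fun i => st i ≤ k + 1) = (U.filter fun i => st i ≤ k) ∪ U₁ := by
      ext i
      simp only [hU₁, mem_filter, mem_union, ← and_or_left]
      refine and_congr_right fun _ => ?_
      omega
    have hUd : Disjoint (U.filter fun i => st i ≤ k) U₁ := by
      refine disjoint_left.2 fun i hi hi' => ?_
      have := (mem_filter.1 hi).2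
      have := (mem_filter.1 hi').2
      omega
    have hLsub : L ⊆ U := hLU.trans (filter_subset _ _)
    obtain ⟨𝒯', L', hP', hLW', hdL', hL', hk', hg'⟩ := exists_packing (f := f) hp hC (hD (k + 1))
      (W := L ∪ U₁)
      (fun i hi => hα i ((mem_union.1 hi).elim (fun h => hLsub h) fun h => (mem_filter.1 h).1))
      (fun i hi => by
        rcases mem_union.1 hi with h | h
        · exact (hord i (hLsub h)).trans (hdvd ((mem_filter.1 (hLU h)).2.trans (Nat.le_succ k)))
        · rw [← (mem_filter.1 h).2]
          exact hord i (mem_filter.1 h).1)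
    have hdT : ∀ T ∈ 𝒯, Disjoint T (L ∪ U₁) := fun T hT =>
      disjoint_union_right.2 ⟨hdL T hT, hUd.mono_left (hP.1 T hT).2.1⟩
    have hsub : L ∪ U₁ ⊆ U.filter fun i => st i ≤ k + 1 := by
      rw [hsplit]
      exact union_subset_union hLU Subset.rfl
    refine ⟨𝒯 ∪ 𝒯', L', (hP.union hP' hdT).mono ?_, hLW'.trans hsub, ?_, hL', ?_⟩
    · refine union_subset ?_ hsub
      rw [hsplit]
      exact subset_union_left
    · intro T hT
      rcases mem_union.1 hT with h | h
      · exact (hdT T h).mono_right hLW'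
      · exact hdL' T h
    · rw [gain_union (hP'.disjoint_of hdT), hsplit, sum_union hUd]
      have h1 : ∑ i ∈ U₁, kap f i * (1 / (D (st i) : ℚ))
          = (∑ i ∈ U₁, kap f i) * (1 / (D (k + 1) : ℚ)) := by
        rw [sum_mul]
        exact sum_congr rfl fun i hi => by rw [(mem_filter.1 hi).2]
      rw [sum_union hLU₁] at hk'
      have h2 : 0 ≤ 1 / (D (k + 1) : ℚ) := by positivity
      have h3 := mul_le_mul_of_nonneg_right hk' h2
      have h4 : 1 / (D (k + 1) : ℚ) ≤ 1 / (D k : ℚ) :=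
        one_div_le_one_div_of_le (by exact_mod_cast hD k)
          (by exact_mod_cast Nat.le_of_dvd (hD _) (hDD k))
      have h5 : ∑ i ∈ L, kap f i ≤ 1 - 1 / (p : ℚ) ^ α :=
        sum_kap_le hp hC (fun i hi => hα i (hLsub hi)) hL
      have h6 := mul_nonneg (sub_nonneg.2 h5) (sub_nonneg.2 h4)
      rw [h1]
      nlinarith

/-- The cost of a chain of orders `D 0 ∣ D 1 ∣ ⋯`. -/
theorem costLE_chain (hp : p.Prime) (hC : SmallTorsion C p)
    (hα : ∀ i ∈ U, p ^ α • (f i).2 = 0) {D : ℕ → ℕ} (hD : ∀ k, 0 < D k)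
    (hDD : ∀ k, D k ∣ D (k + 1)) (st : ι → ℕ)
    (hord : ∀ i ∈ U, addOrderOf (f i).1 ∣ D (st i)) :
    CostLE f U (∑ i ∈ U, kap f i * (1 / (addOrderOf (f i).1 : ℚ) - 1 / (D (st i) : ℚ))
      + (1 - 1 / (p : ℚ) ^ α) * (1 / (D 0 : ℚ))) := by
  classical
  -- At stage `U.sup st` all terms have been processed. Discarding the last leftover costs `(1 - 1 /
  -- p ^ α) / D k`, which completes the telescoping sum to `(1 - 1 / p ^ α) / D 0`.
  obtain ⟨𝒯, L, hP, hLU, -, hL, hg⟩ := exists_packing_chain hp hC hα hD hDD st hord (U.sup st)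
  have hU : (U.filter fun i => st i ≤ U.sup st) = U :=
    filter_true_of_mem fun i hi => le_sup (f := st) hi
  rw [hU] at hP hLU hg
  refine ⟨𝒯, hP, ?_⟩
  have h5 : ∑ i ∈ L, kap f i ≤ 1 - 1 / (p : ℚ) ^ α :=
    sum_kap_le hp hC (fun i hi => hα i (hLU hi)) hL
  have h2 : 0 ≤ 1 / (D (U.sup st) : ℚ) := by positivity
  have h6 := mul_le_mul_of_nonneg_right h5 h2
  simp only [mul_sub, sum_sub_distrib] at hg ⊢
  linarith

/-- The cost of a chain whose first stage certainly contributes one member to the packing. -/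
theorem costLE_chain_of_lt (hp : p.Prime) (hC : SmallTorsion C p) [DecidableEq ι]
    (hUW : Disjoint U W) (hα : ∀ i ∈ U ∪ W, p ^ α • (f i).2 = 0) {D : ℕ → ℕ}
    (hD : ∀ k, 0 < D k) (hDD : ∀ k, D k ∣ D (k + 1)) {D' : ℕ} (hD' : 0 < D') (hDD' : D' ∣ D 0)
    (st : ι → ℕ) (hU : ∀ i ∈ U, addOrderOf (f i).1 ∣ D')
    (hord : ∀ i ∈ W, addOrderOf (f i).1 ∣ D (st i))
    (hlt : 1 - 1 / (p : ℚ) ^ α < ∑ i ∈ U, kap f i) :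
    CostLE f (U ∪ W) (∑ i ∈ U, kap f i * (1 / (addOrderOf (f i).1 : ℚ) - 1 / (D 0 : ℚ))
      + ∑ i ∈ W, kap f i * (1 / (addOrderOf (f i).1 : ℚ) - 1 / (D (st i) : ℚ))
      + (1 - 1 / (p : ℚ) ^ α) * (1 / (D 0 : ℚ)) - (1 / (D' : ℚ) - 1 / (D 0 : ℚ))) := by
  have hαU : ∀ i ∈ U, p ^ α • (f i).2 = 0 := fun i hi => hα i (mem_union_left _ hi)
  obtain ⟨𝒯, L, hP, hLU, hdL, hL, hk, hg⟩ := exists_packing (f := f) hp hC hD' hαU hU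
  have hLW : Disjoint L W := hUW.mono_left hLU
  -- What is left of `U` after packing at order `D'` enters the chain at stage `0`.
  set st' : ι → ℕ := fun i => if i ∈ L then 0 else st i with hst'
  have hstL : ∀ i ∈ L, st' i = 0 := fun i hi => by simp [hst', hi]
  have hstW : ∀ i ∈ W, st' i = st i := fun i hi => by
    have : i ∉ L := fun h => disjoint_left.1 hLW h hi
    simp [hst', this]
  have hsub : L ∪ W ⊆ U ∪ W := union_subset_union hLU Subset.rfl
  obtain ⟨𝒯', hP', hg'⟩ := costLE_chain (f := f) (U := L ∪ W) hp hC (fun i hi => hα i (hsub hi))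
    hD hDD st' (fun i hi => by
      rcases mem_union.1 hi with h | h
      · rw [hstL i h]
        exact (hU i (hLU h)).trans hDD'
      · rw [hstW i h]
        exact hord i h)
  have hdT : ∀ T ∈ 𝒯, Disjoint T (L ∪ W) := fun T hT =>
    disjoint_union_right.2 ⟨hdL T hT, hUW.mono_left (hP.1 T hT).2.1⟩
  refine ⟨𝒯 ∪ 𝒯', (hP.union hP' hdT).mono (union_subset subset_union_left hsub), ?_⟩
  rw [gain_union (hP'.disjoint_of hdT), sum_union hUW]
  rw [sum_union hLW, sum_union hLW] at hg'
  have e1 : ∑ i ∈ L, kap f i * (1 / (addOrderOf (f i).1 : ℚ) - 1 / (D (st' i) : ℚ))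
      = ∑ i ∈ L, kap f i * (1 / (addOrderOf (f i).1 : ℚ) - 1 / (D 0 : ℚ)) :=
    sum_congr rfl fun i hi => by rw [hstL i hi]
  have e2 : ∑ i ∈ W, kap f i * (1 / (addOrderOf (f i).1 : ℚ) - 1 / (D (st' i) : ℚ))
      = ∑ i ∈ W, kap f i * (1 / (addOrderOf (f i).1 : ℚ) - 1 / (D (st i) : ℚ)) :=
    sum_congr rfl fun i hi => by rw [hstW i hi]
  rw [e1, e2] at hg'
  have hLle : ∑ i ∈ L, kap f i ≤ 1 - 1 / (p : ℚ) ^ α :=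
    sum_kap_le hp hC (fun i hi => hαU i (hLU hi)) hL
  -- The leftover weighs at most `1 - 1 / p ^ α`, less than `U`, so at least one member was
  -- extracted. It gains `1 / D'` instead of `1 / D 0`.
  have hN : (1 : ℚ) ≤ #𝒯 := by
    have : 0 < #𝒯 := by
      rw [Nat.pos_iff_ne_zero]
      intro h0
      rw [h0] at hk
      push_cast at hk
      linarith
    exact_mod_cast this
  have h0 : 1 / (D 0 : ℚ) ≤ 1 / (D' : ℚ) :=
    one_div_le_one_div_of_le (by exact_mod_cast hD') (by exact_mod_cast Nat.le_of_dvd (hD 0) hDD')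
  have h1 := mul_nonneg (sub_nonneg.2 hN) (sub_nonneg.2 h0)
  have h2 : 0 ≤ 1 / (D 0 : ℚ) := by positivity
  have h3 := mul_le_mul_of_nonneg_right hk h2
  simp only [mul_sub, sum_sub_distrib, ← sum_mul] at hg' ⊢
  nlinarith

/-- The sums over the packing, together with the terms whose second component vanishes, form a
zero-sum free family over `G`: a zero sum among them would unfold to one in `s`. The bound `k₀`
applies to it, and passing to it has lost at most `x`. -/
theorem ZeroSumFree.crossNum_le_of_costLE.{u, v} {ι : Type u} {G : Type v} [AddCommGroup G]
    {f : ι → G × C} {s : Finset ι} {x k₀ : ℚ} (hG : CrossBound.{u} G k₀) (h : ZeroSumFree s f)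
    (hcop : ∀ i ∈ s, (addOrderOf (f i).1).Coprime (addOrderOf (f i).2))
    [DecidablePred fun i => (f i).2 ≠ 0]
    (hx : CostLE f (s.filter fun i => (f i).2 ≠ 0) x) : crossNum s f ≤ k₀ + x := by
  classical
  obtain ⟨𝒯, hP, hg⟩ := hx
  set B := s.filter fun i => (f i).2 ≠ 0 with hB
  set A := s \ B with hA
  have hA0 : ∀ i ∈ A, (f i).2 = 0 := by
    intro i hi
    have := mem_sdiff.1 hi
    by_contra hne
    exact this.2 (mem_filter.2 ⟨this.1, hne⟩)
  have hBs : B ⊆ s := filter_subset _ _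
  set 𝒬 : Finset (Finset ι) := A.image singleton ∪ 𝒯 with h𝒬
  have hdis : Disjoint (A.image singleton) 𝒯 := by
    refine disjoint_left.2 fun T hT hT' => ?_
    obtain ⟨i, hi, rfl⟩ := mem_image.1 hT
    have := (hP.1 _ hT').2.1 (mem_singleton_self i)
    exact (mem_sdiff.1 hi).2 this
  have h𝒬1 : ∀ T ∈ 𝒬, T.Nonempty ∧ T ⊆ s ∧ ∑ i ∈ T, (f i).2 = 0 := by
    intro T hT
    rcases mem_union.1 hT with hT | hT
    · obtain ⟨i, hi, rfl⟩ := mem_image.1 hT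
      exact ⟨singleton_nonempty i, by simpa using (mem_sdiff.1 hi).1, by simpa using hA0 i hi⟩
    · exact ⟨(hP.1 T hT).1, (hP.1 T hT).2.1.trans hBs, (hP.1 T hT).2.2⟩
  have h𝒬2 : (𝒬 : Set (Finset ι)).PairwiseDisjoint id := by
    have key : ∀ i ∈ A, ∀ T ∈ 𝒯, Disjoint ({i} : Finset ι) T := by
      intro i hi T hT
      rw [disjoint_singleton_left]
      exact fun h' => (mem_sdiff.1 hi).2 ((hP.1 T hT).2.1 h')
    intro T hT T' hT' hne
    rcases mem_union.1 (mem_coe.1 hT) with hT | hT <;>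
    rcases mem_union.1 (mem_coe.1 hT') with hT' | hT'
    · obtain ⟨i, hi, rfl⟩ := mem_image.1 hT
      obtain ⟨j, hj, rfl⟩ := mem_image.1 hT'
      simp only [Function.onFun, id, disjoint_singleton]
      rintro rfl
      exact hne rfl
    · obtain ⟨i, hi, rfl⟩ := mem_image.1 hT
      exact key i hi T' hT'
    · obtain ⟨i, hi, rfl⟩ := mem_image.1 hT'
      exact (key i hi T hT).symm
    · exact hP.2 hT hT' hne
  have hz : ZeroSumFree 𝒬 fun T => ∑ i ∈ T, (f i).1 := by
    intro t ht htne h0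
    have hpd : (t : Set (Finset ι)).PairwiseDisjoint id := h𝒬2.subset (by exact_mod_cast ht)
    refine h (t.biUnion id) ?_ ?_ ?_
    · exact biUnion_subset.2 fun T hT => (h𝒬1 T (ht hT)).2.1
    · obtain ⟨T, hT⟩ := htne
      obtain ⟨i, hi⟩ := (h𝒬1 T (ht hT)).1
      exact ⟨i, mem_biUnion.2 ⟨T, hT, hi⟩⟩
    · rw [sum_biUnion hpd]
      refine Prod.ext ?_ ?_
      · simpa [Prod.fst_sum] using h0
      · simp only [Prod.snd_sum, id, Prod.snd_zero]
        exact sum_eq_zero fun T hT => (h𝒬1 T (ht hT)).2.2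
  have hle := hG _ 𝒬 _ hz
  have e1 : crossNum 𝒬 (fun T => ∑ i ∈ T, (f i).1) = crossNum A f + gain f 𝒯 := by
    unfold crossNum
    rw [h𝒬, sum_union hdis, sum_image (fun i _ j _ h => singleton_injective h)]
    congr 1
    refine sum_congr rfl fun i hi => ?_
    simp only [sum_singleton]
    rw [Prod.addOrderOf, hA0 i hi, addOrderOf_zero, Nat.lcm_one_right]
  have e2 : crossNum B f = ∑ i ∈ B, kap f i * (1 / (addOrderOf (f i).1 : ℚ)) := by
    refine sum_congr rfl fun i hi => ?_
    rw [Prod.addOrderOf, (hcop i (hBs hi)).lcm_eq_mul, kap]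
    push_cast
    rw [one_div_mul_one_div, mul_comm]
  have e3 := crossNum_sdiff_add (f := f) hBs
  rw [e1] at hle
  rw [← e2] at hg
  linarith

end Packing

/-! ### Counting terms by their order; the packing condition -/

theorem sum_geom_levels {p : ℕ} (hp : p.Prime) (α : ℕ) :
    ∑ j ∈ range α, ((p : ℚ) - 1) * (1 / (p : ℚ) ^ (j + 1)) = 1 - 1 / (p : ℚ) ^ α := by
  have hp0 : (0 : ℚ) < p := by exact_mod_cast hp.pos
  induction α with
  | zero => simp
  | succ α ih =>
    rw [sum_range_succ, ih, pow_succ']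
    field_simp
    ring

theorem crossNum_le_of_card_levels {ι C : Type*} [AddCommGroup C] {p : ℕ} (hp : p.Prime)
    {c : ι → C} [DecidableEq C] (n : ℕ → ℚ) (α : ℕ) :
    ∀ {W : Finset ι}, (∀ i ∈ W, c i ≠ 0) → (∀ i ∈ W, p ^ α • c i = 0) →
    (∀ j < α, (#(W.filter fun i => p ^ (j + 1) • c i = 0 ∧ p ^ j • c i ≠ 0) : ℚ) ≤ n j) →
    crossNum W c ≤ ∑ j ∈ range α, n j * (1 / (p : ℚ) ^ (j + 1)) := by
  classical
  induction α with
  | zero =>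
    intro W h0 hα _
    have : W = ∅ := by
      by_contra hne
      obtain ⟨i, hi⟩ := nonempty_iff_ne_empty.2 hne
      exact h0 i hi (by simpa using hα i hi)
    simp [this, crossNum]
  | succ α ih =>
    intro W h0 hα hn
    set U := W.filter fun i => p ^ (α + 1) • c i = 0 ∧ p ^ α • c i ≠ 0 with hU
    have hUW : U ⊆ W := filter_subset _ _
    rw [← crossNum_sdiff_add hUW, sum_range_succ]
    refine add_le_add (ih (fun i hi => h0 i (mem_sdiff.1 hi).1) (fun i hi => ?_) fun j hj => ?_) ?_
    · have := mem_sdiff.1 hi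
      by_contra hne
      exact this.2 (mem_filter.2 ⟨this.1, hα i this.1, hne⟩)
    · refine le_trans ?_ (hn j (by omega))
      exact_mod_cast card_le_card (filter_subset_filter _ sdiff_subset)
    · have : crossNum U c = #U * (1 / (p : ℚ) ^ (α + 1)) := by
        unfold crossNum
        rw [← nsmul_eq_mul]
        exact sum_eq_card_nsmul fun i hi => by
          rw [addOrderOf_of_torsion hp (mem_filter.1 hi).2.1 (mem_filter.1 hi).2.2]
          push_cast
          rfl
      rw [this]
      exact mul_le_mul_of_nonneg_right (hn α (by omega)) (by positivity)

/-- The hypothesis under which the cross number bound passes from `G` to `G × C`. -/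
def Packable.{u, v, w} (G : Type v) (C : Type w) [AddCommGroup G] [AddCommGroup C] (p : ℕ) :
    Prop :=
  ∀ (α : ℕ) (ι : Type u) (B : Finset ι) (f : ι → G × C),
    (∀ i ∈ B, p ^ α • (f i).2 = 0) →
    (∀ d, ∑ i ∈ B with addOrderOf (f i).1 = d, kap f i ≤ 1 - 1 / (p : ℚ) ^ α) →
    (∑ i ∈ B with addOrderOf (f i).1 = 1, kap f i ≤ 1 - 1 / (p : ℚ) ^ α - 1 / p) →
    CostLE f B (1 - 1 / (p : ℚ) ^ α)

/-! ### Adding a cyclic `p`-group: the minimal counterexample -/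

section Step

variable {G C : Type*} [AddCommGroup G] [AddCommGroup C] {p : ℕ}

theorem coprime_addOrderOf_of_torsion (hcop : ∀ g : G, (addOrderOf g).Coprime p) {α : ℕ} (g : G)
    {c : C} (hc : p ^ α • c = 0) : (addOrderOf g).Coprime (addOrderOf c) :=
  ((hcop g).pow_right α).coprime_dvd_right (addOrderOf_dvd_iff_nsmul_eq_zero.2 hc)

theorem one_div_addOrderOf_prod (hcop : ∀ g : G, (addOrderOf g).Coprime p) {α : ℕ} {x : G × C}
    (hx : p ^ α • x.2 = 0) :
    1 / (addOrderOf x : ℚ) = 1 / (addOrderOf x.1 : ℚ) * (1 / (addOrderOf x.2 : ℚ)) := by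
  rw [Prod.addOrderOf, (coprime_addOrderOf_of_torsion hcop x.1 hx).lcm_eq_mul]
  push_cast
  rw [one_div_mul_one_div]

theorem ZeroSumFree.crossNum_le_of_snd_eq_zero.{u, v} {ι : Type u} {G : Type v} [AddCommGroup G]
    {k₀ : ℚ} (hG : CrossBound.{u} G k₀) {s : Finset ι} {f : ι → G × C} (h : ZeroSumFree s f)
    (h0 : ∀ i ∈ s, (f i).2 = 0) : crossNum s f ≤ k₀ := by
  have h1 : ZeroSumFree s fun i => (f i).1 := by
    intro t ht hne hs
    refine h t ht hne (Prod.ext ?_ ?_)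
    · simpa [Prod.fst_sum] using hs
    · simpa [Prod.snd_sum] using sum_eq_zero fun i hi => h0 i (ht hi)
  refine le_trans (le_of_eq (sum_congr rfl fun i hi => ?_)) (hG ι s _ h1)
  rw [Prod.addOrderOf, h0 i hi, addOrderOf_zero, Nat.lcm_one_right]

/-- If `C` has `p - 1` terms of order `p` in a zero-sum free family over `G × C`, these can be
factored out. -/
theorem ZeroSumFree.smul_snd {ι : Type*} [DecidableEq ι] (hC : SmallTorsion C p) {s V : Finset ι}
    {f : ι → G × C} (h : ZeroSumFree s f) (hV : V ⊆ s) (hV1 : ∀ i ∈ V, (f i).1 = 0)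
    (hV2 : ∀ i ∈ V, p • (f i).2 = 0) (hcard : p ≤ #V + 1) :
    ZeroSumFree (s \ V) fun i => ((f i).1, p • (f i).2) := by
  have hVz : ZeroSumFree V fun i => (f i).2 := by
    intro t ht hne hs
    refine h t (ht.trans hV) hne (Prod.ext ?_ ?_)
    · simpa [Prod.fst_sum] using sum_eq_zero fun i hi => hV1 i (ht hi)
    · simpa [Prod.snd_sum] using hs
  intro t ht hne hs
  have hs1 : ∑ i ∈ t, (f i).1 = 0 := by simpa [Prod.fst_sum] using congrArg Prod.fst hs
  have hs2 : p • ∑ i ∈ t, (f i).2 = 0 := by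
    simpa [Prod.snd_sum, smul_sum] using congrArg Prod.snd hs
  obtain ⟨u, hu, hus⟩ := hVz.exists_sum_eq_of_torsion hC hV2 hcard
    (x := -∑ i ∈ t, (f i).2) (by rw [smul_neg, hs2, neg_zero])
  have hd : Disjoint t u :=
    disjoint_left.2 fun i hi hi' => (mem_sdiff.1 (ht hi)).2 (hu hi')
  refine h (t ∪ u) (union_subset (ht.trans sdiff_subset) (hu.trans hV)) (hne.mono subset_union_left) ?_
  rw [sum_union hd]
  refine Prod.ext ?_ ?_
  · simp [Prod.fst_sum, hs1, sum_eq_zero fun i hi => hV1 i (hu hi)]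
  · simp [Prod.snd_sum, hus]

theorem addOrderOf_eq_mul_smul (hp : p.Prime) {α : ℕ} {x : C} (h : p ^ α • x = 0) (hx : x ≠ 0) :
    addOrderOf x = p * addOrderOf (p • x) := by
  obtain ⟨k, -, hk⟩ := (Nat.dvd_prime_pow hp).1 (addOrderOf_dvd_iff_nsmul_eq_zero.2 h)
  have hk0 : k ≠ 0 := by
    rintro rfl
    exact hx (AddMonoid.addOrderOf_eq_one_iff.1 (by simpa using hk))
  have hdvd : p ∣ addOrderOf x := hk ▸ dvd_pow_self p hk0
  rw [addOrderOf_nsmul' x hp.ne_zero, Nat.gcd_eq_right hdvd, Nat.mul_div_cancel' hdvd]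

/-- A counterexample with the least `α`, and then the fewest terms, admits no amalgamation that
preserves the cross number. This yields exactly the weight bounds that `Packable` asks for, except
when the terms `(0, c)` of order `p` fill the `p`-torsion of `C`; then `α` is lowered instead. -/
theorem ZeroSumFree.crossNum_prod_le.{u, v, w} {G : Type v} {C : Type w} [AddCommGroup G]
    [AddCommGroup C] (hp : p.Prime) (hC : SmallTorsion C p)
    (hcop : ∀ g : G, (addOrderOf g).Coprime p) {k₀ : ℚ} (hG : CrossBound.{u} G k₀)
    (hpack : Packable.{u} G C p) (α : ℕ) :
    ∀ {ι : Type u} {s : Finset ι} {f : ι → G × C}, ZeroSumFree s f →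
      (∀ i ∈ s, p ^ α • (f i).2 = 0) → crossNum s f ≤ k₀ + (1 - 1 / (p : ℚ) ^ α) := by
  classical
  have hp0 : (0 : ℚ) < p := by exact_mod_cast hp.pos
  induction α with
  | zero =>
    intro ι s f h hs
    simpa using h.crossNum_le_of_snd_eq_zero hG fun i hi => by simpa using hs i hi
  | succ α ih =>
    intro ι s
    induction hn : #s using Nat.strong_induction_on generalizing s with
    | _ n ihn =>
    intro f h hs
    by_contra! hcon
    have hord : ∀ i ∈ s, 1 / (addOrderOf (f i) : ℚ) =
        1 / (addOrderOf (f i).1 : ℚ) * kap f i :=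
      fun i hi => one_div_addOrderOf_prod hcop (hs i hi)
    have hpos : ∀ g : G, 0 < addOrderOf g := by
      intro g
      rw [Nat.pos_iff_ne_zero]
      intro h0
      have := hcop g
      rw [h0, Nat.coprime_zero_left] at this
      exact hp.one_lt.ne' this
    -- The amalgamated family is shorter and hence obeys the bound, while `s` violates it.
    have hred : ∀ t ⊆ s, 2 ≤ #t → 1 / (addOrderOf (∑ i ∈ t, f i) : ℚ) < crossNum t f := by
      intro t ht htc
      obtain ⟨i₀, hi₀⟩ : t.Nonempty := card_pos.1 (by omega)
      have hca := card_amalgamate ht hi₀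
      have hle := ihn _ (by omega) rfl (h.amalgamate ht hi₀) (by
        intro i hi
        rcases mem_insert.1 hi with rfl | hi'
        · rw [Function.update_self, Prod.snd_sum, smul_sum]
          exact sum_eq_zero fun j hj => hs j (ht hj)
        · have hne : i ≠ i₀ := fun h' => (mem_sdiff.1 hi').2 (h' ▸ hi₀)
          rw [Function.update_of_ne hne]
          exact hs i (mem_sdiff.1 hi').1)
      unfold crossNum at hle
      rw [sum_amalgamate hi₀ (fun x => 1 / (addOrderOf x : ℚ))] at hle
      have h3 := crossNum_sdiff_add (f := f) ht
      unfold crossNum at h3 hcon ⊢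
      linarith
    set B := s.filter fun i => (f i).2 ≠ 0 with hB
    have hBs : B ⊆ s := filter_subset _ _
    have htwo : ∀ t ⊆ s, t.Nonempty → (∀ i ∈ t, t ≠ {i}) → 2 ≤ #t := by
      intro t _ hne h1
      by_contra hlt
      have hpos := card_pos.2 hne
      obtain ⟨i, rfl⟩ := card_eq_one.1 (show #t = 1 by omega)
      exact h1 i (mem_singleton_self i) rfl
    -- Second components with a minimal zero sum over `T` would allow an amalgamation: the cross
    -- number of `T` is at most `1 / d`, and its sum has order dividing `d`, contradicting `hred`.
    -- So they are zero-sum free.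
    have hβ : ∀ d, ∑ i ∈ B with addOrderOf (f i).1 = d, kap f i ≤ 1 - 1 / (p : ℚ) ^ (α + 1) := by
      intro d
      refine sum_kap_le hp hC (fun i hi => hs i (hBs (mem_filter.1 hi).1)) ?_
      by_contra hz
      obtain ⟨T, hT, hTne, hT0, hmin⟩ := exists_minimal_zero_sum hz
      have hTB : T ⊆ B := hT.trans (filter_subset _ _)
      have hTs := hTB.trans hBs
      have hT1 : ∑ i ∈ T, kap f i ≤ 1 := crossNum_le_one_of_minimal (c := fun i => (f i).2) hp hC
        hTne (fun i hi => hs i (hTs hi)) hmin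
      have hd : ∀ i ∈ T, addOrderOf (f i).1 = d := fun i hi => (mem_filter.1 (hT hi)).2
      have hd0 : 0 < d := by
        obtain ⟨i, hi⟩ := hTne
        exact hd i hi ▸ hpos _
      have h1 := hred T hTs (htwo T hTs hTne fun i hi h' => by
        rw [h', sum_singleton] at hT0
        exact (mem_filter.1 (hTB hi)).2 hT0)
      have h2 : crossNum T f = 1 / (d : ℚ) * ∑ i ∈ T, kap f i := by
        unfold crossNum
        rw [mul_sum]
        exact sum_congr rfl fun i hi => by rw [hord i (hTs hi), hd i hi]
      have h3 : 1 / (d : ℚ) ≤ 1 / (addOrderOf (∑ i ∈ T, f i) : ℚ) := by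
        refine one_div_addOrderOf_ge hd0 (Prod.ext ?_ ?_)
        · rw [Prod.smul_fst, Prod.fst_sum, smul_sum]
          exact sum_eq_zero fun i hi => by
            rw [← hd i hi]
            exact addOrderOf_nsmul_eq_zero _
        · rw [Prod.smul_snd, Prod.snd_sum, hT0, smul_zero]
          rfl
      have h4 : 1 / (d : ℚ) * ∑ i ∈ T, kap f i ≤ 1 / (d : ℚ) * 1 :=
        mul_le_mul_of_nonneg_left hT1 (by positivity)
      linarith
    -- Among `p` terms `(0, c)` of order `p ^ (j + 1)`, some would have a sum of order dividing `p ^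
    -- j`, and at most `p` of them have cross number at most `1 / p ^ j`.
    have hlevel : ∀ j, #(s.filter fun i => (f i).1 = 0 ∧ p ^ (j + 1) • (f i).2 = 0 ∧
        p ^ j • (f i).2 ≠ 0) < p := by
      intro j
      by_contra! hle
      obtain ⟨t, ht, hne, htp, ht0⟩ := exists_subset_torsion_sum (c := fun i => (f i).2) hC hle
        (fun i hi => (mem_filter.1 hi).2.2.1)
      have hts := ht.trans (filter_subset _ _)
      have h1 := hred t hts (htwo t hts hne fun i hi h' => by
        rw [h', sum_singleton] at ht0
        exact (mem_filter.1 (ht hi)).2.2.2 ht0)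
      have h2 : crossNum t f = #t * (1 / (p : ℚ) ^ (j + 1)) := by
        unfold crossNum
        rw [← nsmul_eq_mul]
        refine sum_eq_card_nsmul fun i hi => ?_
        have hi' := (mem_filter.1 (ht hi)).2
        rw [hord i (hts hi), hi'.1, addOrderOf_zero, kap, addOrderOf_of_torsion hp hi'.2.1 hi'.2.2]
        push_cast
        ring
      have h3 : 1 / ((p ^ j : ℕ) : ℚ) ≤ 1 / (addOrderOf (∑ i ∈ t, f i) : ℚ) := by
        refine one_div_addOrderOf_ge (pow_pos hp.pos j) (Prod.ext ?_ ?_)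
        · rw [Prod.smul_fst, Prod.fst_sum, sum_eq_zero fun i hi => (mem_filter.1 (ht hi)).2.1,
            smul_zero]
          rfl
        · rw [Prod.smul_snd, Prod.snd_sum, ht0]
          rfl
      have h4 : (#t : ℚ) * (1 / (p : ℚ) ^ (j + 1)) ≤ p * (1 / (p : ℚ) ^ (j + 1)) := by gcongr
      have h5 : (p : ℚ) * (1 / (p : ℚ) ^ (j + 1)) = 1 / (p : ℚ) ^ j := by
        rw [pow_succ']
        field_simp
      push_cast at h3
      linarith
    set V₀ := s.filter fun i => (f i).1 = 0 ∧ p • (f i).2 = 0 with hV₀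
    have hV₀s : V₀ ⊆ s := filter_subset _ _
    have hV₀ne : ∀ i ∈ V₀, (f i).2 ≠ 0 := by
      intro i hi h0
      exact h.ne_zero (hV₀s hi) (Prod.ext (mem_filter.1 hi).2.1 h0)
    have hV₀eq : V₀ = s.filter fun i => (f i).1 = 0 ∧ p ^ (0 + 1) • (f i).2 = 0 ∧
        p ^ 0 • (f i).2 ≠ 0 := by
      ext i
      simp only [hV₀, mem_filter, zero_add, pow_one, pow_zero, one_smul]
      constructor
      · rintro ⟨hi, h1, h2⟩
        exact ⟨hi, h1, h2, hV₀ne i (mem_filter.2 ⟨hi, h1, h2⟩)⟩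
      · rintro ⟨hi, h1, h2, -⟩
        exact ⟨hi, h1, h2⟩
    have hV₀card : #V₀ < p := hV₀eq ▸ hlevel 0
    -- If `V₀` has `p - 1` terms, its subset sums absorb any `p`-torsion, so the remaining terms
    -- stay zero-sum free after multiplying second components by `p`, and `α` decreases.
    by_cases hfull : p ≤ #V₀ + 1
    · have hz := h.smul_snd hC hV₀s (fun i hi => (mem_filter.1 hi).2.1)
        (fun i hi => (mem_filter.1 hi).2.2) hfull
      have hz' := ih hz (fun i hi => by
        rw [smul_smul, ← pow_succ]
        exact hs i (mem_sdiff.1 hi).1)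
      set A := (s \ V₀).filter fun i => (f i).2 = 0 with hA
      have hAs : A ⊆ s \ V₀ := filter_subset _ _
      have hkA := (h.mono (hAs.trans sdiff_subset)).crossNum_le_of_snd_eq_zero hG
        (fun i hi => (mem_filter.1 hi).2)
      have e1 := crossNum_sdiff_add (f := f) hAs
      have e2 := crossNum_sdiff_add (f := fun i => ((f i).1, p • (f i).2)) hAs
      have e3 := crossNum_sdiff_add (f := f) hV₀s
      have e4 : crossNum A (fun i => ((f i).1, p • (f i).2)) = crossNum A f := by
        refine sum_congr rfl fun i hi => ?_
        have h0 : (f i).2 = 0 := (mem_filter.1 hi).2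
        have : ((f i).1, p • (f i).2) = f i := Prod.ext rfl (by simp [h0])
        beta_reduce
        rw [this]
      have e5 : crossNum ((s \ V₀) \ A) f
          = 1 / (p : ℚ) * crossNum ((s \ V₀) \ A) (fun i => ((f i).1, p • (f i).2)) := by
        unfold crossNum
        rw [mul_sum]
        refine sum_congr rfl fun i hi => ?_
        have hi1 := mem_sdiff.1 hi
        have his := (mem_sdiff.1 hi1.1).1
        have h0 : (f i).2 ≠ 0 := fun h0 => hi1.2 (mem_filter.2 ⟨hi1.1, h0⟩)
        rw [hord i his, one_div_addOrderOf_prod (p := p) (α := α) hcop (by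
          rw [smul_smul, ← pow_succ]
          exact hs i his)]
        simp only
        rw [kap, addOrderOf_eq_mul_smul hp (hs i his) h0]
        push_cast
        rw [← one_div_mul_one_div]
        ring
      have e6 : crossNum V₀ f ≤ 1 - 1 / (p : ℚ) := by
        have : crossNum V₀ f = #V₀ * (1 / (p : ℚ)) := by
          unfold crossNum
          rw [← nsmul_eq_mul]
          refine sum_eq_card_nsmul fun i hi => ?_
          have hi' := (mem_filter.1 hi).2
          have := Fact.mk hp
          rw [hord i (hV₀s hi), hi'.1, addOrderOf_zero, kap,
            addOrderOf_eq_prime hi'.2 (hV₀ne i hi)]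
          simp
        rw [this]
        have h1 : ((#V₀ + 1 : ℕ) : ℚ) ≤ p := by exact_mod_cast hV₀card
        push_cast at h1
        have h2 : (#V₀ : ℚ) * (1 / (p : ℚ)) ≤ ((p : ℚ) - 1) * (1 / (p : ℚ)) := by
          gcongr
          linarith
        have h3 : ((p : ℚ) - 1) * (1 / (p : ℚ)) = 1 - 1 / p := by field_simp
        linarith
      rw [e4] at e2
      have hpinv : 0 < 1 / (p : ℚ) := by positivity
      have hpinv1 : 1 / (p : ℚ) ≤ 1 := by
        rw [div_le_one hp0]
        exact_mod_cast hp.one_lt.le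
      -- The total is bounded by `e6`, plus `1 / p` times the induction bound `hz'`, plus `1 - 1 /
      -- p` times the bound `k₀` for `A`, since terms of `A` do not change order under
      -- multiplication by `p`.
      have h6 := mul_le_mul_of_nonneg_left hz' hpinv.le
      have h7 := mul_le_mul_of_nonneg_left hkA (sub_nonneg.2 hpinv1)
      have h8 : 1 / (p : ℚ) * (1 / (p : ℚ) ^ α) = 1 / (p : ℚ) ^ (α + 1) := by
        rw [one_div_mul_one_div, pow_succ']
      rw [← e2] at h6
      nlinarith
    · have hV : ∑ i ∈ B with addOrderOf (f i).1 = 1, kap f i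
          ≤ 1 - 1 / (p : ℚ) ^ (α + 1) - 1 / p := by
        -- There are at most `p - 1` terms at each level, and only `p - 2` at level `0` because
        -- `hfull` fails. The missing term of order `p` accounts for the `- 1 / p`.
        have key := crossNum_le_of_card_levels (c := fun i => (f i).2) hp
          (fun j => ((p : ℚ) - 1) - if j = 0 then 1 else 0) (α + 1)
          (W := B.filter fun i => addOrderOf (f i).1 = 1)
          (fun i hi => (mem_filter.1 (mem_filter.1 hi).1).2)
          (fun i hi => hs i (hBs (mem_filter.1 hi).1)) (by
            intro j _
            have hsub : ((B.filter fun i => addOrderOf (f i).1 = 1).filter fun i =>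
                p ^ (j + 1) • (f i).2 = 0 ∧ p ^ j • (f i).2 ≠ 0) ⊆
                s.filter fun i => (f i).1 = 0 ∧ p ^ (j + 1) • (f i).2 = 0 ∧
                p ^ j • (f i).2 ≠ 0 := by
              intro i hi
              simp only [mem_filter, AddMonoid.addOrderOf_eq_one_iff] at hi ⊢
              exact ⟨hBs hi.1.1, hi.1.2, hi.2⟩
            have hle := card_le_card hsub
            split_ifs with hj
            · subst hj
              rw [← hV₀eq] at hle
              have : #((B.filter fun i => addOrderOf (f i).1 = 1).filter fun i =>
                p ^ (0 + 1) • (f i).2 = 0 ∧ p ^ 0 • (f i).2 ≠ 0) + 2 ≤ p := by omega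
              have : ((#((B.filter fun i => addOrderOf (f i).1 = 1).filter fun i =>
                p ^ (0 + 1) • (f i).2 = 0 ∧ p ^ 0 • (f i).2 ≠ 0) + 2 : ℕ) : ℚ) ≤ p := by
                exact_mod_cast this
              push_cast at this
              linarith
            · have h1 := hlevel j
              have : #((B.filter fun i => addOrderOf (f i).1 = 1).filter fun i =>
                p ^ (j + 1) • (f i).2 = 0 ∧ p ^ j • (f i).2 ≠ 0) + 1 ≤ p := by omega
              have : ((#((B.filter fun i => addOrderOf (f i).1 = 1).filter fun i =>
                p ^ (j + 1) • (f i).2 = 0 ∧ p ^ j • (f i).2 ≠ 0) + 1 : ℕ) : ℚ) ≤ p := by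
                exact_mod_cast this
              push_cast at this
              linarith)
        refine le_trans key (le_of_eq ?_)
        simp only [sub_mul _ (ite _ _ _), sum_sub_distrib, ite_mul, one_mul, zero_mul]
        rw [sum_geom_levels hp, sum_ite_eq' (range (α + 1)) 0]
        simp
      have hcost := hpack (α + 1) ι B f (fun i hi => hs i (hBs hi)) hβ hV
      have := h.crossNum_le_of_costLE hG
        (fun i hi => coprime_addOrderOf_of_torsion hcop _ (hs i hi)) hcost
      linarith

end Step

/-! ### Lines `c * q ^ k` and the generic packing estimate -/

section Lines

variable {ι G C : Type*} [AddCommGroup G] [AddCommGroup C]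

/-- The total weight of the terms whose first component has order `d`. -/
noncomputable def beta (f : ι → G × C) (B : Finset ι) (d : ℕ) : ℚ :=
  ∑ i ∈ B with addOrderOf (f i).1 = d, kap f i

/-- The terms whose first component has order `c * q ^ k` for some `k`, where `q ∤ c`. -/
noncomputable def line (f : ι → G × C) (B : Finset ι) (q c : ℕ) : Finset ι :=
  B.filter fun i => ordCompl[q] (addOrderOf (f i).1) = c

open Classical in
/-- The terms for which the order of the first component satisfies `P`. -/
noncomputable def sel (f : ι → G × C) (B : Finset ι) (P : ℕ → Prop) : Finset ι :=
  B.filter fun i => P (addOrderOf (f i).1)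

variable {f : ι → G × C} {B : Finset ι} {q c : ℕ}

theorem beta_nonneg (f : ι → G × C) (B : Finset ι) (d : ℕ) : 0 ≤ beta f B d :=
  sum_nonneg fun i _ => kap_nonneg f i

theorem mem_sel {P : ℕ → Prop} {i : ι} : i ∈ sel f B P ↔ i ∈ B ∧ P (addOrderOf (f i).1) := by
  simp [sel]

theorem sum_sel {P : ℕ → Prop} {Y : Finset ℕ} (F : ℕ → ℚ) (hY : ∀ d ∈ Y, P d)
    (hF : ∀ d, P d → d ∉ Y → F d = 0) :
    ∑ i ∈ sel f B P, kap f i * F (addOrderOf (f i).1) = ∑ d ∈ Y, beta f B d * F d := by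
  classical
  have h1 : ∑ i ∈ B with addOrderOf (f i).1 ∈ Y, kap f i * F (addOrderOf (f i).1)
      = ∑ i ∈ sel f B P, kap f i * F (addOrderOf (f i).1) := by
    refine sum_subset ?_ ?_
    · intro i hi
      exact mem_sel.2 ⟨(mem_filter.1 hi).1, hY _ (mem_filter.1 hi).2⟩
    · intro i hi hi'
      obtain ⟨h1, h2⟩ := mem_sel.1 hi
      rw [hF _ h2 fun h => hi' (mem_filter.2 ⟨h1, h⟩), mul_zero]
  have hm : ∀ i ∈ B.filter (fun i => addOrderOf (f i).1 ∈ Y), addOrderOf (f i).1 ∈ Y :=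
    fun i hi => (mem_filter.1 hi).2
  rw [← h1, ← sum_fiberwise_of_maps_to hm]
  refine sum_congr rfl fun d hd => ?_
  rw [beta, sum_mul]
  refine sum_congr ?_ fun i hi => by rw [(mem_filter.1 hi).2]
  ext i
  simp only [mem_filter]
  constructor
  · rintro ⟨⟨h1, h2⟩, h3⟩
    exact ⟨h1, h3⟩
  · rintro ⟨h1, h2⟩
    exact ⟨⟨h1, h2 ▸ hd⟩, h2⟩

theorem ordCompl_eq_self (h : ¬ q ∣ c) : ordCompl[q] c = c := by
  rw [Nat.factorization_eq_zero_of_not_dvd h, pow_zero, Nat.div_one]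

theorem eq_mul_pow_of_ordCompl_eq {n : ℕ} (h : ordCompl[q] n = c) :
    n = c * q ^ n.factorization q := by
  rw [← h, mul_comm, Nat.ordProj_mul_ordCompl_eq_self]

theorem sum_line (hc : ¬ q ∣ c) (F : ℕ → ℚ) (hF : ∀ k, F (c * q ^ (k + 1)) = 0) :
    ∑ i ∈ line f B q c, kap f i * F (addOrderOf (f i).1) = beta f B c * F c := by
  classical
  rw [beta, sum_mul]
  symm
  refine (sum_congr rfl fun i hi => by rw [← (mem_filter.1 hi).2]).trans
    (sum_subset_zero_on_sdiff (g := fun i => kap f i * F (addOrderOf (f i).1)) ?_ ?_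
      fun _ _ => rfl)
  · intro i hi
    refine mem_filter.2 ⟨(mem_filter.1 hi).1, ?_⟩
    rw [(mem_filter.1 hi).2]
    exact ordCompl_eq_self hc
  · intro i hi
    obtain ⟨h1, h2⟩ := mem_sdiff.1 hi
    have h3 := eq_mul_pow_of_ordCompl_eq (mem_filter.1 h1).2
    have h4 : (addOrderOf (f i).1).factorization q ≠ 0 := by
      intro h0
      rw [h0, pow_zero, mul_one] at h3
      exact h2 (mem_filter.2 ⟨(mem_filter.1 h1).1, h3⟩)
    obtain ⟨k, hk⟩ := Nat.exists_eq_succ_of_ne_zero h4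
    rw [hk] at h3
    rw [h3, hF k, mul_zero]

variable {p α : ℕ}

/-- In the chain `c * q, c * q ^ 2, …` only the terms of order `c` itself are rounded up. All others
already sit at their own order. -/
theorem costLE_line (hp : p.Prime) (hC : SmallTorsion C p) (hα : ∀ i ∈ B, p ^ α • (f i).2 = 0)
    (hq : q.Prime) (hc : ¬ q ∣ c) :
    CostLE f (line f B q c) (beta f B c * (1 / (c : ℚ) - 1 / ((c * q : ℕ) : ℚ))
      + (1 - 1 / (p : ℚ) ^ α) * (1 / ((c * q : ℕ) : ℚ))) := by
  have hc0 : 0 < c := Nat.pos_of_ne_zero fun h => hc (h ▸ dvd_zero q)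
  have h := costLE_chain (f := f) (U := line f B q c) hp hC
    (fun i hi => hα i (mem_filter.1 hi).1)
    (D := fun k => c * q ^ (k + 1)) (fun k => by have := hq.pos; positivity)
    (fun k => by rw [pow_succ, pow_succ, pow_succ]; exact ⟨q, by ring⟩)
    -- Truncated subtraction puts both `c` and `c * q` into stage `0`.
    (fun i => (addOrderOf (f i).1).factorization q - 1) (fun i hi => by
      have h3 := eq_mul_pow_of_ordCompl_eq (mem_filter.1 hi).2
      refine h3.dvd.trans (mul_dvd_mul_left c (pow_dvd_pow q (by omega))))
  refine h.mono_right (le_of_eq ?_)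
  rw [sum_line (f := f) (B := B) hc (fun d => 1 / (d : ℚ) -
    1 / ((c * q ^ (d.factorization q - 1 + 1) : ℕ) : ℚ)) ?_]
  · rw [Nat.factorization_eq_zero_of_not_dvd hc]
    simp
  · intro k
    have : (c * q ^ (k + 1)).factorization q = k + 1 := by
      rw [Nat.factorization_mul hc0.ne' (pow_ne_zero _ hq.ne_zero), Finsupp.add_apply,
        Nat.factorization_eq_zero_of_not_dvd hc, hq.factorization_pow]
      simp
    rw [this]
    simp

theorem line_pairwiseDisjoint (f : ι → G × C) (B : Finset ι) (q : ℕ) (X : Set ℕ) :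
    X.PairwiseDisjoint (line f B q) := by
  intro c _ c' _ hne
  refine disjoint_left.2 fun i hi hi' => hne ?_
  rw [← (mem_filter.1 hi).2, (mem_filter.1 hi').2]

theorem ordCompl_mem_divisors (hq : q.Prime) {n' a d : ℕ} (hn' : n' ≠ 0) (hd : d ∣ q ^ a * n') :
    ordCompl[q] d ∈ n'.divisors := by
  have hd0 : d ≠ 0 := fun h => by
    rw [h, zero_dvd_iff, mul_eq_zero] at hd
    exact hd.elim (pow_ne_zero _ hq.ne_zero) hn'
  rw [Nat.mem_divisors]
  refine ⟨?_, hn'⟩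
  have h1 : (ordCompl[q] d).Coprime (q ^ a) := ((Nat.coprime_ordCompl hq hd0).symm).pow_right a
  exact h1.dvd_of_dvd_mul_left ((Nat.ordCompl_dvd d q).trans hd)

theorem not_dvd_of_mem_divisors {n' : ℕ} (hqn : ¬ q ∣ n') (hc : c ∈ n'.divisors) : ¬ q ∣ c :=
  fun h => hqn (h.trans (Nat.dvd_of_mem_divisors hc))

theorem biUnion_line [DecidableEq ι] (hq : q.Prime) {n' a : ℕ} (hn' : n' ≠ 0)
    (hN : ∀ g : G, addOrderOf g ∣ q ^ a * n') (X : Finset ℕ) :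
    (n'.divisors \ X).biUnion (line f B q)
      = B.filter fun i => ordCompl[q] (addOrderOf (f i).1) ∉ X := by
  ext i
  simp only [mem_biUnion, mem_sdiff, line, mem_filter]
  constructor
  · rintro ⟨c, ⟨-, h2⟩, h3, h4⟩
    exact ⟨h3, h4 ▸ h2⟩
  · rintro ⟨h1, h2⟩
    exact ⟨_, ⟨ordCompl_mem_divisors hq hn' (hN _), h2⟩, h1, rfl⟩

/-- Since `beta f B c ≤ 1 - 1 / p ^ α`, the line of `c` costs at most `(1 - 1 / p ^ α) / c`. The
lines in `X` are left out, to be packed more economically. -/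
theorem costLE_lines [DecidableEq ι] (hp : p.Prime) (hC : SmallTorsion C p)
    (hα : ∀ i ∈ B, p ^ α • (f i).2 = 0) (hβ : ∀ d, beta f B d ≤ 1 - 1 / (p : ℚ) ^ α)
    (hq : q.Prime) {n' a : ℕ} (hqn : ¬ q ∣ n')
    (hN : ∀ g : G, addOrderOf g ∣ q ^ a * n') {X : Finset ℕ} (hX : X ⊆ n'.divisors) :
    CostLE f (B.filter fun i => ordCompl[q] (addOrderOf (f i).1) ∉ X)
      ((1 - 1 / (p : ℚ) ^ α) * (∑ c ∈ n'.divisors, 1 / (c : ℚ) - ∑ c ∈ X, 1 / (c : ℚ))) := by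
  have hn' : n' ≠ 0 := fun h => hqn (h ▸ dvd_zero q)
  rw [← biUnion_line hq hn' hN X, ← sum_sdiff hX, add_sub_cancel_right, mul_sum]
  refine CostLE.biUnion _ _ _ (fun c hc => ?_) (line_pairwiseDisjoint f B q _)
  have hqc := not_dvd_of_mem_divisors hqn (mem_sdiff.1 hc).1
  refine (costLE_line hp hC hα hq hqc).mono_right ?_
  have hc0 : 0 < c := Nat.pos_of_ne_zero fun h => hqc (h ▸ dvd_zero q)
  have h1 : 1 / ((c * q : ℕ) : ℚ) ≤ 1 / (c : ℚ) :=
    one_div_le_one_div_of_le (by exact_mod_cast hc0)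
      (by exact_mod_cast Nat.le_mul_of_pos_right c hq.pos)
  have := mul_le_mul_of_nonneg_right (hβ c) (sub_nonneg.2 h1)
  linarith

theorem CostLE.of_filter [DecidableEq ι] {P : ι → Prop} [DecidablePred P] {x y z : ℚ}
    (h1 : CostLE f (B.filter P) x) (h2 : CostLE f (B.filter fun i => ¬ P i) y)
    (hz : x + y ≤ z) : CostLE f B z := by
  have := h1.union h2 (disjoint_filter_filter_not B B P)
  rw [filter_union_filter_not_eq] at this
  exact this.mono_right hz

/-- The deficit `1 / p` in the weight at order `1` saves `(1 / p) * (1 - 1 / q)` on the line of `1`,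
which pays for all the other lines. -/
theorem packable_of_sum_divisors.{u} (hp : p.Prime) (hC : SmallTorsion C p) (hq : q.Prime)
    {n' a : ℕ} (hqn : ¬ q ∣ n') (hN : ∀ g : G, addOrderOf g ∣ q ^ a * n')
    (hS : ∑ c ∈ n'.divisors, 1 / (c : ℚ) ≤ 1 + 1 / (p : ℚ) * (1 - 1 / (q : ℚ))) :
    Packable.{u} G C p := by
  classical
  intro α ι B f hα hβ hV
  have hn' : n' ≠ 0 := fun h => hqn (h ▸ dvd_zero q)
  have hX : ({1} : Finset ℕ) ⊆ n'.divisors := by simp [hn']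
  have h1 := costLE_lines hp hC hα hβ hq hqn hN hX
  have hq1 : ¬ q ∣ 1 := fun h => hq.one_lt.ne' (Nat.dvd_one.1 h)
  have h2 := costLE_line hp hC hα hq hq1
  have hV' : beta f B 1 ≤ 1 - 1 / (p : ℚ) ^ α - 1 / p := hV
  have e : line f B q 1 = B.filter fun i => ordCompl[q] (addOrderOf (f i).1) ∈ ({1} : Finset ℕ) := by
    simp [line]
  rw [e] at h2
  refine CostLE.of_filter h2 h1 ?_
  have hq0 : (1 : ℚ) ≤ q := by exact_mod_cast hq.one_lt.le
  have h3 : 0 ≤ 1 - 1 / (q : ℚ) := by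
    rw [sub_nonneg, div_le_one (by linarith)]
    exact hq0
  have h4 := mul_le_mul_of_nonneg_right hV' h3
  have h5 : (1 : ℚ) ≤ ∑ c ∈ n'.divisors, 1 / (c : ℚ) := by
    have := sum_le_sum_of_subset_of_nonneg hX (f := fun c : ℕ => 1 / (c : ℚ))
      (fun _ _ _ => by positivity)
    simpa using this
  have h6 : 0 ≤ 1 / (p : ℚ) ^ α := by positivity
  have h7 := mul_nonneg h6 (sub_nonneg.2 h5)
  simp only [sum_singleton, Nat.cast_one, one_mul, div_one]
  nlinarith

end Lines

/-! ### Cost of selected sets of orders -/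

section Sel

variable {ι G C : Type*} [AddCommGroup G] [AddCommGroup C]
variable {f : ι → G × C} {B : Finset ι} {p α : ℕ}

theorem sel_disjoint {P Q : ℕ → Prop} (h : ∀ d, P d → ¬ Q d) : Disjoint (sel f B P) (sel f B Q) :=
  disjoint_left.2 fun _ hi hi' => h _ (mem_sel.1 hi).2 (mem_sel.1 hi').2

theorem sel_or [DecidableEq ι] (P Q : ℕ → Prop) :
    sel f B P ∪ sel f B Q = sel f B fun d => P d ∨ Q d := by
  ext i
  simp only [mem_union, mem_sel]
  tauto

theorem costLE_sel_trivial (d : ℕ) : CostLE f (sel f B (· = d)) (beta f B d * (1 / (d : ℚ))) := by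
  have h := costLE_trivial f (sel f B (· = d))
  rw [sum_sel (Y := {d}) (fun d => 1 / (d : ℚ)) (by simp) (by simp)] at h
  simpa using h

/-- The set `Y` contains every order that the chain really rounds up, so the rounding cost becomes a
finite sum of values of `beta`. -/
theorem costLE_sel (hp : p.Prime) (hC : SmallTorsion C p) (hα : ∀ i ∈ B, p ^ α • (f i).2 = 0)
    {P : ℕ → Prop} {D st : ℕ → ℕ} (hD : ∀ k, 0 < D k) (hDD : ∀ k, D k ∣ D (k + 1))
    (hord : ∀ d, P d → d ∣ D (st d)) (Y : Finset ℕ) (hY : ∀ d ∈ Y, P d)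
    (hF : ∀ d, P d → d ∉ Y → d = D (st d)) :
    CostLE f (sel f B P) (∑ d ∈ Y, beta f B d * (1 / (d : ℚ) - 1 / (D (st d) : ℚ))
      + (1 - 1 / (p : ℚ) ^ α) * (1 / (D 0 : ℚ))) := by
  have h := costLE_chain (f := f) (U := sel f B P) hp hC (fun i hi => hα i (mem_sel.1 hi).1)
    hD hDD (fun i => st (addOrderOf (f i).1)) (fun i hi => hord _ (mem_sel.1 hi).2)
  rwa [sum_sel (fun d => 1 / (d : ℚ) - 1 / (D (st d) : ℚ)) hY
    (fun d h1 h2 => by rw [← hF d h1 h2, sub_self])] at h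

theorem costLE_sel_of_lt [DecidableEq ι] (hp : p.Prime) (hC : SmallTorsion C p)
    (hα : ∀ i ∈ B, p ^ α • (f i).2 = 0) {Q : ℕ → Prop} {D st : ℕ → ℕ} (hD : ∀ k, 0 < D k)
    (hDD : ∀ k, D k ∣ D (k + 1)) {D' : ℕ} (hD' : 0 < D') (hDD' : D' ∣ D 0) (Y : Finset ℕ)
    (hYQ : ∀ d ∈ Y, ¬ Q d) (hY : ∀ d ∈ Y, d ∣ D') (hF : ∀ d, Q d → d = D (st d))
    (hlt : 1 - 1 / (p : ℚ) ^ α < ∑ d ∈ Y, beta f B d) :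
    CostLE f (sel f B fun d => d ∈ Y ∨ Q d)
      (∑ d ∈ Y, beta f B d * (1 / (d : ℚ) - 1 / (D 0 : ℚ))
      + (1 - 1 / (p : ℚ) ^ α) * (1 / (D 0 : ℚ)) - (1 / (D' : ℚ) - 1 / (D 0 : ℚ))) := by
  rw [← sel_or]
  have h := costLE_chain_of_lt (f := f) (U := sel f B (· ∈ Y)) (W := sel f B Q) hp hC
    (sel_disjoint hYQ) (fun i hi => hα i ?_) hD hDD hD' hDD'
    (fun i => st (addOrderOf (f i).1)) (fun i hi => hY _ (mem_sel.1 hi).2)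
    (fun i hi => (hF _ (mem_sel.1 hi).2).dvd) ?_
  · rw [sum_sel (Y := Y) (fun d => 1 / (d : ℚ) - 1 / (D 0 : ℚ)) (fun d hd => hd)
      (fun d h1 h2 => absurd h1 h2),
      sum_sel (Y := ∅) (fun d => 1 / (d : ℚ) - 1 / (D (st d) : ℚ)) (by simp)
      (fun d h1 _ => by rw [← hF d h1, sub_self])] at h
    simpa using h
  · rcases mem_union.1 hi with h | h <;> exact (mem_sel.1 h).1
  · have := sum_sel (f := f) (B := B) (P := (· ∈ Y)) (Y := Y) (fun _ => 1) (fun d hd => hd)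
      (fun d h1 h2 => absurd h1 h2)
    simp only [mul_one] at this
    rwa [this]

/-- The cost of terms whose orders divide a common value and whose weights exceed `1 - 1 / p ^ α`. -/
theorem costLE_of_lt (hp : p.Prime) (hC : SmallTorsion C p)
    (hα : ∀ i ∈ B, p ^ α • (f i).2 = 0) {D' : ℕ} (hD' : 0 < D') (Y : Finset ℕ)
    (hY : ∀ d ∈ Y, d ∣ D') (hlt : 1 - 1 / (p : ℚ) ^ α < ∑ d ∈ Y, beta f B d) :
    CostLE f (sel f B (· ∈ Y)) (∑ d ∈ Y, beta f B d * (1 / (d : ℚ)) - 1 / (D' : ℚ)) := by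
  have hα' : ∀ i ∈ sel f B (· ∈ Y), p ^ α • (f i).2 = 0 := fun i hi => hα i (mem_sel.1 hi).1
  obtain ⟨𝒯, L, hP, hLU, hdL, hL, hk, hg⟩ := exists_packing (f := f) hp hC hD' hα'
    (fun i hi => hY _ (mem_sel.1 hi).2)
  have e := sum_sel (f := f) (B := B) (P := (· ∈ Y)) (Y := Y) (fun _ => 1) (fun d hd => hd)
    (fun d h1 h2 => absurd h1 h2)
  simp only [mul_one] at e
  have hLle : ∑ i ∈ L, kap f i ≤ 1 - 1 / (p : ℚ) ^ α :=
    sum_kap_le hp hC (fun i hi => hα' i (hLU hi)) hL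
  have hN : (1 : ℚ) ≤ #𝒯 := by
    have : 0 < #𝒯 := by
      rw [Nat.pos_iff_ne_zero]
      intro h0
      rw [h0] at hk
      push_cast at hk
      linarith
    exact_mod_cast this
  refine ⟨𝒯, hP, ?_⟩
  rw [sum_sel (Y := Y) (fun d => 1 / (d : ℚ)) (fun d hd => hd) (fun d h1 h2 => absurd h1 h2)]
  have := mul_le_mul_of_nonneg_right hN (show 0 ≤ 1 / (D' : ℚ) by positivity)
  linarith

theorem costLE_of_sel [DecidableEq ι] {P : ℕ → Prop} {X : Finset ℕ} {q : ℕ} {x y z : ℚ}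
    (hP : ∀ i ∈ B, ordCompl[q] (addOrderOf (f i).1) ∈ X ↔ P (addOrderOf (f i).1))
    (h1 : CostLE f (sel f B P) x)
    (h2 : CostLE f (B.filter fun i => ordCompl[q] (addOrderOf (f i).1) ∉ X) y)
    (hz : x + y ≤ z) : CostLE f B z := by
  have e : sel f B P = B.filter fun i => ordCompl[q] (addOrderOf (f i).1) ∈ X := by
    ext i
    rw [mem_sel, mem_filter]
    exact and_congr_right fun hi => (hP i hi).symm
  rw [e] at h1
  exact h1.of_filter h2 hz

theorem costLE_sel_or [DecidableEq ι] {P Q : ℕ → Prop} {x y : ℚ} (h1 : CostLE f (sel f B P) x)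
    (h2 : CostLE f (sel f B Q) y) (h : ∀ d, P d → ¬ Q d) :
    CostLE f (sel f B fun d => P d ∨ Q d) (x + y) := by
  rw [← sel_or]
  exact h1.union h2 (sel_disjoint h)

theorem ordCompl_eq_iff {q c d : ℕ} (hq : q.Prime) (hc : ¬ q ∣ c) :
    ordCompl[q] d = c ↔ ∃ k, d = c * q ^ k := by
  refine ⟨fun h => ⟨_, eq_mul_pow_of_ordCompl_eq h⟩, ?_⟩
  rintro ⟨k, rfl⟩
  have hc0 : c ≠ 0 := fun h => hc (h ▸ dvd_zero q)
  rw [Nat.factorization_mul hc0 (pow_ne_zero _ hq.ne_zero), Finsupp.add_apply,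
    Nat.factorization_eq_zero_of_not_dvd hc, hq.factorization_pow]
  simp [hq.pos]

theorem log_mul_pow_div {c : ℕ} (hc : 0 < c) (k : ℕ) : Nat.log 3 (c * 3 ^ k / c) = k := by
  rw [Nat.mul_div_cancel_left _ hc, Nat.log_pow (by norm_num)]

/-- The cost of a line `c * 3 ^ k` together with the terms of trivial first component, when their
weights are large enough. -/
theorem costLE_rounded [DecidableEq ι] (hp : p.Prime) (hC : SmallTorsion C p)
    (hα : ∀ i ∈ B, p ^ α • (f i).2 = 0) {c : ℕ} (hc : 1 < c) (h3 : ¬ 3 ∣ c)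
    (hlt : 1 - 1 / (p : ℚ) ^ α < beta f B 1 + beta f B c) :
    CostLE f (sel f B fun d => d = 1 ∨ ∃ k, d = c * 3 ^ k)
      (beta f B 1 * (1 - 1 / (3 * c)) + beta f B c * (2 / (3 * c))
        + (1 - 1 / (p : ℚ) ^ α) * (1 / (3 * c)) - 2 / (3 * c)) := by
  have hc0 : (0 : ℚ) < c := by exact_mod_cast hc.le
  -- Orders `1` and `c` are together heavy enough for one zero sum of order dividing `D' = c`. Only
  -- what remains is rounded up to `3 * c`, saving `1 / c - 1 / (3 * c) = 2 / (3 * c)`.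
  have h := costLE_sel_of_lt (f := f) (B := B) (Q := fun d => ∃ k, d = c * 3 ^ (k + 1))
    (D := fun k => c * 3 ^ (k + 1)) (st := fun d => Nat.log 3 (d / c) - 1) (D' := c)
    (Y := {1, c}) hp hC hα (fun k => by positivity)
    (fun k => ⟨3, by ring⟩) (by omega) ⟨3, by ring⟩ ?_ ?_ ?_ ?_
  · rw [sum_pair hc.ne] at h
    have e : (fun d => d ∈ ({1, c} : Finset ℕ) ∨ ∃ k, d = c * 3 ^ (k + 1))
        = fun d => d = 1 ∨ ∃ k, d = c * 3 ^ k := by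
      funext d
      refine propext ?_
      rw [mem_insert, mem_singleton, or_assoc]
      refine or_congr_right ⟨?_, ?_⟩
      · rintro (rfl | ⟨k, rfl⟩)
        · exact ⟨0, by simp⟩
        · exact ⟨k + 1, rfl⟩
      · rintro ⟨k, rfl⟩
        cases k with
        | zero => left; simp
        | succ k => exact Or.inr ⟨k, rfl⟩
    rw [e] at h
    refine h.mono_right (le_of_eq ?_)
    push_cast
    field_simp
    ring
  · intro d hd
    rintro ⟨k, rfl⟩
    rw [mem_insert, mem_singleton] at hd
    rcases hd with hd | hd
    · exact absurd (Nat.eq_one_of_mul_eq_one_right hd) hc.ne'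
    · have : 3 ^ (k + 1) = 1 := by
        nlinarith [Nat.one_lt_pow (n := k + 1) (a := 3) (by omega) (by omega)]
      simp at this
  · intro d hd
    rw [mem_insert, mem_singleton] at hd
    rcases hd with rfl | rfl <;> simp
  · rintro d ⟨k, rfl⟩
    simp only [log_mul_pow_div (by omega : 0 < c)]
    rfl
  · rwa [sum_pair hc.ne]

theorem costLE_powers_of_three [DecidableEq ι] (hp : p.Prime) (hC : SmallTorsion C p)
    (hα : ∀ i ∈ B, p ^ α • (f i).2 = 0) :
    CostLE f (sel f B fun d => ∃ k, d = 3 ^ (k + 1))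
      (beta f B 3 * (2 / 9) + (1 - 1 / (p : ℚ) ^ α) * (1 / 9)) := by
  have h := costLE_sel (f := f) (B := B) (P := fun d => ∃ k, d = 3 ^ (k + 1))
    -- The chain starts at `9`. Truncated subtraction keeps `3` and `9` both in stage `0`.
    (D := fun k => 3 ^ (k + 2)) (st := fun d => Nat.log 3 d - 2) hp hC hα
    (fun k => by positivity) (fun k => ⟨3, by ring⟩) ?_ {3} ?_ ?_
  · refine h.mono_right (le_of_eq ?_)
    norm_num
  · rintro d ⟨k, rfl⟩
    rw [Nat.log_pow (by norm_num)]
    exact pow_dvd_pow 3 (by omega)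
  · intro d hd
    rw [mem_singleton] at hd
    exact ⟨0, by rw [hd]; rfl⟩
  · rintro d ⟨k, rfl⟩ hd
    rw [Nat.log_pow (by norm_num)]
    cases k with
    | zero => simp at hd
    | succ k => congr 1

/-- One zero sum of order dividing `3` is guaranteed among the orders `1` and `3`; the chain for the
rest starts only at `9`, and the difference `1 / 3 - 1 / 9 = 2 / 9` is saved. -/
theorem costLE_powers_of_three_of_lt [DecidableEq ι] (hp : p.Prime) (hC : SmallTorsion C p)
    (hα : ∀ i ∈ B, p ^ α • (f i).2 = 0)
    (hlt : 1 - 1 / (p : ℚ) ^ α < beta f B 1 + beta f B 3) :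
    CostLE f (sel f B fun d => ∃ k, d = 3 ^ k)
      (beta f B 1 * (8 / 9) + beta f B 3 * (2 / 9) + (1 - 1 / (p : ℚ) ^ α) * (1 / 9) - 2 / 9) := by
  have h := costLE_sel_of_lt (f := f) (B := B) (Q := fun d => ∃ k, d = 3 ^ (k + 2))
    (D := fun k => 3 ^ (k + 2)) (st := fun d => Nat.log 3 d - 2) (D' := 3)
    (Y := {1, 3}) hp hC hα (fun k => by positivity)
    (fun k => ⟨3, by ring⟩) (by omega) ⟨3, by ring⟩ ?_ ?_ ?_ ?_
  · rw [sum_pair (by norm_num)] at h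
    have e : (fun d => d ∈ ({1, 3} : Finset ℕ) ∨ ∃ k, d = 3 ^ (k + 2))
        = fun d => ∃ k, d = 3 ^ k := by
      funext d
      refine propext ?_
      rw [mem_insert, mem_singleton, or_assoc]
      constructor
      · rintro (rfl | rfl | ⟨k, rfl⟩)
        · exact ⟨0, rfl⟩
        · exact ⟨1, rfl⟩
        · exact ⟨k + 2, rfl⟩
      · rintro ⟨k, rfl⟩
        match k with
        | 0 => left; rfl
        | 1 => right; left; rfl
        | k + 2 => exact Or.inr (Or.inr ⟨k, rfl⟩)
    rw [e] at h
    refine h.mono_right (le_of_eq ?_)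
    norm_num
  · intro d hd
    rintro ⟨k, rfl⟩
    rw [mem_insert, mem_singleton, pow_succ, pow_succ] at hd
    omega
  · decide
  · rintro d ⟨k, rfl⟩
    rw [Nat.log_pow (by norm_num)]
    rfl
  · rwa [sum_pair (by norm_num)]

theorem costLE_divisors_fifteen [DecidableEq ι] (hp : p.Prime) (hC : SmallTorsion C p)
    (hα : ∀ i ∈ B, p ^ α • (f i).2 = 0) :
    CostLE f (sel f B (· ∈ ({1, 3, 5, 15} : Finset ℕ)))
      (beta f B 1 * (14 / 15) + beta f B 3 * (4 / 15) + beta f B 5 * (2 / 15)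
        + (1 - 1 / (p : ℚ) ^ α) * (1 / 15)) := by
  have h := costLE_sel (f := f) (B := B) (P := (· ∈ ({1, 3, 5, 15} : Finset ℕ)))
    (D := fun k => 15) (st := fun d => 0) hp hC hα (by simp) (by simp) (by decide)
    {1, 3, 5, 15} (by simp) (fun d h1 h2 => absurd h1 h2)
  refine h.mono_right (le_of_eq ?_)
  rw [sum_insert (by decide), sum_insert (by decide), sum_pair (by decide)]
  norm_num
  ring

theorem costLE_proper_divisors_fifteen [DecidableEq ι] (hp : p.Prime) (hC : SmallTorsion C p)
    (hα : ∀ i ∈ B, p ^ α • (f i).2 = 0) :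
    CostLE f (sel f B (· ∈ ({3, 5, 15} : Finset ℕ)))
      (beta f B 3 * (4 / 15) + beta f B 5 * (2 / 15) + (1 - 1 / (p : ℚ) ^ α) * (1 / 15)) := by
  have h := costLE_sel (f := f) (B := B) (P := (· ∈ ({3, 5, 15} : Finset ℕ)))
    (D := fun k => 15) (st := fun d => 0) hp hC hα (by simp) (by simp) (by decide)
    {3, 5, 15} (by simp) (fun d h1 h2 => absurd h1 h2)
  refine h.mono_right (le_of_eq ?_)
  rw [sum_insert (by decide), sum_pair (by decide)]
  norm_num

/-- Divisors of `15` are rounded up to `15`, while `25` and `75` enter the chain one stage later, at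
`75`. The coefficients are the differences of the inverse orders, such as `1 / 25 - 1 / 75 = 2 /
75`. -/
theorem costLE_divisors_seventy_five [DecidableEq ι] (hp : p.Prime) (hC : SmallTorsion C p)
    (hα : ∀ i ∈ B, p ^ α • (f i).2 = 0) :
    CostLE f (sel f B (· ∈ ({1, 3, 5, 15, 25, 75} : Finset ℕ)))
      (beta f B 1 * (14 / 15) + beta f B 3 * (4 / 15) + beta f B 5 * (2 / 15)
        + beta f B 25 * (2 / 75) + (1 - 1 / (p : ℚ) ^ α) * (1 / 15)) := by
  have h := costLE_sel (f := f) (B := B) (P := (· ∈ ({1, 3, 5, 15, 25, 75} : Finset ℕ)))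
    (D := fun k => 15 * 5 ^ k) (st := fun d => if 25 ∣ d then 1 else 0) hp hC hα
    (fun k => by positivity) (fun k => ⟨5, by ring⟩) (by decide)
    {1, 3, 5, 15, 25, 75} (by simp) (fun d h1 h2 => absurd h1 h2)
  refine h.mono_right (le_of_eq ?_)
  rw [sum_insert (by decide), sum_insert (by decide), sum_insert (by decide),
    sum_insert (by decide), sum_pair (by decide)]
  norm_num
  ring

end Sel

/-! ### The primes `2` and `3`: merging lines -/

section TwoThree

variable {ι G C : Type*} [AddCommGroup G] [AddCommGroup C]
variable {f : ι → G × C} {B : Finset ι} {α n' a : ℕ}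

/-- When `3` divides the exponent only once, every line has just two orders, so lines can be
regrouped into finite sets such as the divisors of `15`. -/
theorem ordCompl_three_eq_iff_of_dvd {c d n' : ℕ} (hc : ¬ 3 ∣ c) (hn' : ¬ 3 ∣ n')
    (hd : d ∣ 3 * n') : ordCompl[3] d = c ↔ d = c ∨ d = c * 3 := by
  rw [ordCompl_eq_iff Nat.prime_three hc]
  constructor
  · rintro ⟨k, rfl⟩
    match k with
    | 0 => left; simp
    | 1 => right; simp
    | k + 2 =>
      exfalso
      refine hn' (Nat.dvd_of_mul_dvd_mul_left (by norm_num : 0 < 3) ?_)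
      refine Dvd.dvd.trans ?_ hd
      exact ⟨c * 3 ^ k, by ring⟩
  · rintro (rfl | rfl)
    · exact ⟨0, by simp⟩
    · exact ⟨1, by simp⟩

/-- Numerical conditions on the sum `h` of the inverses of the divisors of `n'`. -/
structure DivisorBounds (n' a : ℕ) (h : ℚ) : Prop where
  one : a = 1 → h ≤ 3 / 2
  two : a ≠ 1 → h ≤ 18 / 13
  not_five : ¬ 5 ∣ n' → h ≤ 49 / 36
  not_five_seven : ¬ 5 ∣ n' → ¬ 7 ∣ n' → h ≤ 121 / 100
  not_seven_twenty_five : ¬ 7 ∣ n' → ¬ 25 ∣ n' → h ≤ 363 / 250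
  not_seven_eleven : ¬ 7 ∣ n' → ¬ 11 ∣ n' → h ≤ 845 / 576

variable [DecidableEq ι]

/-- The generic estimate with `p = 2` and `q = 3`: the line of `1` saves `(1 / 2) * (2 / 3) = 1 /
3`. -/
theorem costLE_one_line {m : ℚ} (hm0 : 1 - 1 / ((2 : ℕ) : ℚ) ^ α = m)
    (hC : SmallTorsion C 2) (hα : ∀ i ∈ B, 2 ^ α • (f i).2 = 0)
    (hβ : ∀ d, beta f B d ≤ m)
    (hV : beta f B 1 ≤ m - 1 / 2) (h3 : ¬ 3 ∣ n')
    (hN : ∀ g : G, addOrderOf g ∣ 3 ^ a * n') {h : ℚ}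
    (hh : ∑ c ∈ n'.divisors, 1 / (c : ℚ) = h)
    (hm : m * (h - 1) ≤ 1 / 3) :
    CostLE f B m := by
  have hn' : n' ≠ 0 := fun h => h3 (h ▸ dvd_zero 3)
  have h1 := costLE_line (c := 1) Nat.prime_two hC hα Nat.prime_three (by norm_num)
  have h2 := costLE_lines Nat.prime_two hC hα (hm0 ▸ hβ) Nat.prime_three h3 hN (X := {1}) (by simp [hn'])
  have e : line f B 3 1 = B.filter fun i => ordCompl[3] (addOrderOf (f i).1) ∈ ({1} : Finset ℕ) := by
    simp [line]
  rw [e] at h1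
  rw [hm0] at h1
  rw [hm0, hh] at h2
  refine h1.of_filter h2 ?_
  simp only [sum_singleton]
  norm_num
  linarith

/-- The guaranteed zero sum of order dividing `3` lowers the cost of the line of `1` to at most `11
* m / 9 - 2 / 3`. Together with `5 * m / 13` this stays below `m` since `m ≤ 1`. -/
theorem costLE_of_three_large {m : ℚ} (hm0 : 1 - 1 / ((2 : ℕ) : ℚ) ^ α = m)
    (hC : SmallTorsion C 2) (hα : ∀ i ∈ B, 2 ^ α • (f i).2 = 0)
    (hβ : ∀ d, beta f B d ≤ m)
    (hV : beta f B 1 ≤ m - 1 / 2) (h3 : ¬ 3 ∣ n')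
    (hN : ∀ g : G, addOrderOf g ∣ 3 ^ a * n') {h : ℚ}
    (hh : ∑ c ∈ n'.divisors, 1 / (c : ℚ) = h)
    (hm1 : m ≤ 1)
    (hlt : m < beta f B 1 + beta f B 3)
    (hm : m * (h - 1) ≤ m * (5 / 13)) :
    CostLE f B m := by
  have hn' : n' ≠ 0 := fun h => h3 (h ▸ dvd_zero 3)
  have h1 := costLE_powers_of_three_of_lt Nat.prime_two hC hα (hm0 ▸ hlt)
  rw [hm0] at h1
  have h2 := costLE_lines Nat.prime_two hC hα (hm0 ▸ hβ) Nat.prime_three h3 hN (X := {1}) (by simp [hn'])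
  rw [hm0, hh, sum_singleton] at h2
  refine costLE_of_sel (fun i _ => ?_) h1 h2 ?_
  · rw [mem_singleton, ordCompl_eq_iff Nat.prime_three (by norm_num)]
    simp
  · have := hβ 3
    norm_num
    linarith

theorem costLE_of_three_large_of_exp_one {m : ℚ} (hm0 : 1 - 1 / ((2 : ℕ) : ℚ) ^ α = m)
    (hC : SmallTorsion C 2)
    (hα : ∀ i ∈ B, 2 ^ α • (f i).2 = 0)
    (hβ : ∀ d, beta f B d ≤ m)
    (hV : beta f B 1 ≤ m - 1 / 2) (h3 : ¬ 3 ∣ n')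
    (hN : ∀ g : G, addOrderOf g ∣ 3 ^ 1 * n') {h : ℚ}
    (hh : ∑ c ∈ n'.divisors, 1 / (c : ℚ) = h)
    (hm1 : m ≤ 1)
    (hlt : m < beta f B 1 + beta f B 3)
    (hm : m * (h - 1) ≤ m * (1 / 2)) :
    CostLE f B m := by
  have hn' : n' ≠ 0 := fun h => h3 (h ▸ dvd_zero 3)
  have h1 := costLE_of_lt Nat.prime_two hC hα (D' := 3) (by norm_num) {1, 3} (by decide)
    (by rwa [sum_pair (by norm_num), hm0])
  rw [sum_pair (by norm_num)] at h1
  have h2 := costLE_lines Nat.prime_two hC hα (hm0 ▸ hβ) Nat.prime_three h3 hN (X := {1}) (by simp [hn'])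
  rw [hm0, hh, sum_singleton] at h2
  refine costLE_of_sel (fun i _ => ?_) h1 h2 ?_
  · rw [mem_singleton, ordCompl_three_eq_iff_of_dvd (by norm_num) h3 (hN _)]
    simp
  · have := hβ 3
    norm_num
    linarith

/-- Here the line of `c` is either cheap or can be rounded together with the terms of trivial
first component. -/
theorem costLE_of_second_line {m : ℚ} (hm0 : 1 - 1 / ((2 : ℕ) : ℚ) ^ α = m)
    (hC : SmallTorsion C 2) (hα : ∀ i ∈ B, 2 ^ α • (f i).2 = 0)
    (hβ : ∀ d, beta f B d ≤ m)
    (hV : beta f B 1 ≤ m - 1 / 2) (h3 : ¬ 3 ∣ n')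
    (hN : ∀ g : G, addOrderOf g ∣ 3 ^ a * n') {h : ℚ}
    (hh : ∑ c ∈ n'.divisors, 1 / (c : ℚ) = h)
    (hm1 : m ≤ 1)
    (hle : beta f B 1 + beta f B 3 ≤ m) {c : ℕ} (hcn : c ∈ n'.divisors)
    (hc : c = 5 ∧ m * (h - 1) ≤ m * (5 / 13) ∨
      c = 7 ∧ m * (h - 1) ≤ m * (13 / 36)) :
    CostLE f B m := by
  have hn' : n' ≠ 0 := fun h => h3 (h ▸ dvd_zero 3)
  have hc1 : 1 < c := by omega
  have h3c : ¬ 3 ∣ c := by omega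
  have h2 := costLE_lines Nat.prime_two hC hα (hm0 ▸ hβ) Nat.prime_three h3 hN (X := {1, c})
    (by rw [insert_subset_iff, singleton_subset_iff]; exact ⟨by simp [hn'], hcn⟩)
  rw [sum_pair hc1.ne, hh, hm0] at h2
  have hβc := hβ c
  -- If the sum is small, both lines are packed separately. If it is large, the terms of order `1`
  -- move to the line of `c`, where a zero sum is guaranteed, and the powers of `3` from `3` on form
  -- a chain of their own.
  rcases le_or_gt (beta f B 1 + beta f B c) m with hlt | hlt
  · have h0 := costLE_line (c := 1) Nat.prime_two hC hα Nat.prime_three (by norm_num)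
    have h1 := costLE_line (c := c) Nat.prime_two hC hα Nat.prime_three h3c
    have hd : Disjoint (line f B 3 1) (line f B 3 c) :=
      line_pairwiseDisjoint f B 3 Set.univ trivial trivial hc1.ne
    rw [hm0] at h0 h1
    have h4 := h0.union h1 hd
    have e : line f B 3 1 ∪ line f B 3 c
        = B.filter fun i => ordCompl[3] (addOrderOf (f i).1) ∈ ({1, c} : Finset ℕ) := by
      ext i
      simp only [line, mem_union, mem_filter, mem_insert, mem_singleton]
      tauto
    rw [e] at h4
    refine h4.of_filter h2 ?_
    rcases hc with ⟨rfl, hm⟩ | ⟨rfl, hm⟩ <;> norm_num <;> linarith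
  · have h0 := costLE_powers_of_three (f := f) (B := B) Nat.prime_two hC hα
    have h1 := costLE_rounded Nat.prime_two hC hα hc1 h3c (hm0 ▸ hlt)
    rw [hm0] at h0 h1
    have h4 := costLE_sel_or h0 h1 ?_
    · refine costLE_of_sel (fun i _ => ?_) h4 h2 ?_
      · rw [mem_insert, mem_singleton, ordCompl_eq_iff Nat.prime_three (by norm_num),
          ordCompl_eq_iff Nat.prime_three h3c, ← or_assoc]
        refine or_congr_left ?_
        constructor
        · rintro ⟨k, hk⟩
          rw [one_mul] at hk
          cases k with
          | zero => exact Or.inr hk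
          | succ k => exact Or.inl ⟨k, hk⟩
        · rintro (⟨k, hk⟩ | hk)
          · exact ⟨k + 1, by rw [hk, one_mul]⟩
          · exact ⟨0, by simpa using hk⟩
      · rcases hc with ⟨rfl, hm⟩ | ⟨rfl, hm⟩ <;> norm_num <;> linarith
    · rintro d ⟨k, rfl⟩ (h | ⟨j, h⟩)
      · simp at h
      · have h5 : c ∣ 3 ^ (k + 1) := ⟨_, h⟩
        obtain ⟨l, -, rfl⟩ := (Nat.dvd_prime_pow Nat.prime_three).1 h5
        cases l with
        | zero => simp at hc1
        | succ l => exact h3c (dvd_pow_self 3 (by omega))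

end TwoThree

/-! ### The case `3 ∥ exp` with `5 ∣ n'` -/

section Five

variable {ι G C : Type*} [AddCommGroup G] [AddCommGroup C]
variable {f : ι → G × C} {B : Finset ι} {α n' : ℕ}
variable [DecidableEq ι]

/-- The terms of order `1` join the line of `5`, and those of order `3` are simply discarded. The
resulting bound `43 * m / 30 - 13 / 30` equals `m` at `m = 1`, so there is no slack here. -/
theorem costLE_of_five_large {m : ℚ} (hm0 : 1 - 1 / ((2 : ℕ) : ℚ) ^ α = m)
    (hC : SmallTorsion C 2) (hα : ∀ i ∈ B, 2 ^ α • (f i).2 = 0)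
    (hβ : ∀ d, beta f B d ≤ m) (hV : beta f B 1 ≤ m - 1 / 2) (h3 : ¬ 3 ∣ n')
    (hN : ∀ g : G, addOrderOf g ∣ 3 * n') {h : ℚ} (hh : ∑ c ∈ n'.divisors, 1 / (c : ℚ) = h)
    (hm1 : m ≤ 1) (hle : beta f B 1 + beta f B 3 ≤ m) (h5 : 5 ∈ n'.divisors)
    (hlt : m < beta f B 1 + beta f B 5) (hm : m * (h - 1) ≤ m * (1 / 2)) : CostLE f B m := by
  have hn' : n' ≠ 0 := fun h => h3 (h ▸ dvd_zero 3)
  have h2 := costLE_lines (a := 1) Nat.prime_two hC hα (hm0 ▸ hβ) Nat.prime_three h3 hN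
    (X := {1, 5}) (by rw [insert_subset_iff, singleton_subset_iff]; exact ⟨by simp [hn'], h5⟩)
  have h1 := costLE_rounded Nat.prime_two hC hα (c := 5) (by norm_num) (by norm_num) (hm0 ▸ hlt)
  rw [hm0] at h1
  rw [hm0, hh, sum_pair (by norm_num)] at h2
  refine costLE_of_sel (fun i _ => ?_) (costLE_sel_or (costLE_sel_trivial 3) h1 ?_) h2 ?_
  · rw [mem_insert, mem_singleton, ordCompl_three_eq_iff_of_dvd (by norm_num) h3 (hN _),
      ordCompl_eq_iff Nat.prime_three (by norm_num)]
    simp only [one_mul]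
    tauto
  · rintro d rfl (h | ⟨k, h⟩) <;> omega
  · have := hβ 5
    norm_num
    linarith

/-- The terms of order `1` join the line of `c`; the orders `3`, `5` and `15` are packed together at
`15`. -/
theorem costLE_of_seven_or_eleven_large {m : ℚ} (hm0 : 1 - 1 / ((2 : ℕ) : ℚ) ^ α = m)
    (hC : SmallTorsion C 2) (hα : ∀ i ∈ B, 2 ^ α • (f i).2 = 0)
    (hβ : ∀ d, beta f B d ≤ m) (hV : beta f B 1 ≤ m - 1 / 2) (h3 : ¬ 3 ∣ n')
    (hN : ∀ g : G, addOrderOf g ∣ 3 * n') {h : ℚ} (hh : ∑ c ∈ n'.divisors, 1 / (c : ℚ) = h)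
    (hm1 : m ≤ 1) (hle : beta f B 1 + beta f B 3 ≤ m) (h5 : 5 ∈ n'.divisors)
    (hle5 : beta f B 1 + beta f B 5 ≤ m) {c : ℕ} (hc : c = 7 ∨ c = 11) (hcn : c ∈ n'.divisors)
    (hlt : m < beta f B 1 + beta f B c) (hm : m * (h - 1) ≤ m * (1 / 2)) : CostLE f B m := by
  have hn' : n' ≠ 0 := fun h => h3 (h ▸ dvd_zero 3)
  have hc1 : 1 < c := by omega
  have h3c : ¬ 3 ∣ c := by omega
  have hc5 : 5 ≠ c := by omega
  have h1c : 1 ∉ ({5, c} : Finset ℕ) := by simp [hc1.ne]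
  have h2 := costLE_lines (a := 1) Nat.prime_two hC hα (hm0 ▸ hβ) Nat.prime_three h3 hN
    (X := {1, 5, c}) (by
      rw [insert_subset_iff, insert_subset_iff, singleton_subset_iff]
      exact ⟨by simp [hn'], h5, hcn⟩)
  have h1 := costLE_rounded Nat.prime_two hC hα hc1 h3c (hm0 ▸ hlt)
  have h0 := costLE_proper_divisors_fifteen (f := f) (B := B) Nat.prime_two hC hα
  rw [hm0] at h0 h1
  rw [hm0, hh, sum_insert h1c, sum_pair hc5] at h2
  refine costLE_of_sel (fun i _ => ?_) (costLE_sel_or h0 h1 ?_) h2 ?_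
  · simp only [mem_insert, mem_singleton]
    rw [ordCompl_three_eq_iff_of_dvd (c := 1) (by norm_num) h3 (hN _),
      ordCompl_three_eq_iff_of_dvd (c := 5) (by norm_num) h3 (hN _),
      ordCompl_eq_iff Nat.prime_three h3c]
    simp only [one_mul]
    norm_num
    tauto
  · intro d hd
    simp only [mem_insert, mem_singleton] at hd
    rintro (h | ⟨k, h⟩)
    · omega
    · have : c ∣ d := ⟨_, h⟩
      rcases hc with rfl | rfl <;> omega
  · have := hβ c
    rcases hc with rfl | rfl <;> norm_num <;> linarith

/-- The bounds on `β 1 + β c` make `β 3`, `β 5` and `β 7` small when `β 1` is large, so packing the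
divisors of `15` at `15` and the orders `7`, `21` at `21` is cheap enough. -/
theorem costLE_of_seven {m : ℚ} (hm0 : 1 - 1 / ((2 : ℕ) : ℚ) ^ α = m)
    (hC : SmallTorsion C 2) (hα : ∀ i ∈ B, 2 ^ α • (f i).2 = 0)
    (hβ : ∀ d, beta f B d ≤ m) (hV : beta f B 1 ≤ m - 1 / 2) (h3 : ¬ 3 ∣ n')
    (hN : ∀ g : G, addOrderOf g ∣ 3 * n') {h : ℚ} (hh : ∑ c ∈ n'.divisors, 1 / (c : ℚ) = h)
    (hm1 : m ≤ 1) (hle : beta f B 1 + beta f B 3 ≤ m) (h5 : 5 ∈ n'.divisors)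
    (hle5 : beta f B 1 + beta f B 5 ≤ m) (h7 : 7 ∈ n'.divisors)
    (hle7 : beta f B 1 + beta f B 7 ≤ m) (hm : m * (h - 1) ≤ m * (1 / 2)) : CostLE f B m := by
  have hn' : n' ≠ 0 := fun h => h3 (h ▸ dvd_zero 3)
  have h2 := costLE_lines (a := 1) Nat.prime_two hC hα (hm0 ▸ hβ) Nat.prime_three h3 hN
    (X := {1, 5, 7}) (by
      rw [insert_subset_iff, insert_subset_iff, singleton_subset_iff]
      exact ⟨by simp [hn'], h5, h7⟩)
  have h1 := costLE_sel (f := f) (B := B) (P := (· ∈ ({7, 21} : Finset ℕ)))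
    (D := fun k => 21) (st := fun d => 0) Nat.prime_two hC hα (by simp) (by simp) (by decide)
    {7, 21} (by simp) (fun d h1 h2 => absurd h1 h2)
  have h0 := costLE_divisors_fifteen (f := f) (B := B) Nat.prime_two hC hα
  rw [hm0] at h0 h1
  rw [sum_pair (by decide)] at h1
  rw [hm0, hh, sum_insert (by decide), sum_pair (by decide)] at h2
  refine costLE_of_sel (fun i _ => ?_) (costLE_sel_or h0 h1 ?_) h2 ?_
  · simp only [mem_insert, mem_singleton]
    rw [ordCompl_three_eq_iff_of_dvd (c := 1) (by norm_num) h3 (hN _),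
      ordCompl_three_eq_iff_of_dvd (c := 5) (by norm_num) h3 (hN _),
      ordCompl_three_eq_iff_of_dvd (c := 7) (by norm_num) h3 (hN _)]
    norm_num
    tauto
  · decide
  · norm_num
    linarith

theorem costLE_of_not_seven_twenty_five {m : ℚ} (hm0 : 1 - 1 / ((2 : ℕ) : ℚ) ^ α = m)
    (hC : SmallTorsion C 2) (hα : ∀ i ∈ B, 2 ^ α • (f i).2 = 0)
    (hβ : ∀ d, beta f B d ≤ m) (hV : beta f B 1 ≤ m - 1 / 2) (h3 : ¬ 3 ∣ n')
    (hN : ∀ g : G, addOrderOf g ∣ 3 * n') {h : ℚ} (hh : ∑ c ∈ n'.divisors, 1 / (c : ℚ) = h)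
    (hm1 : m ≤ 1) (hle : beta f B 1 + beta f B 3 ≤ m) (h5 : 5 ∈ n'.divisors)
    (hle5 : beta f B 1 + beta f B 5 ≤ m) (hm : m * (h - 1) ≤ m * (113 / 250)) :
    CostLE f B m := by
  have hn' : n' ≠ 0 := fun h => h3 (h ▸ dvd_zero 3)
  have h2 := costLE_lines (a := 1) Nat.prime_two hC hα (hm0 ▸ hβ) Nat.prime_three h3 hN
    (X := {1, 5}) (by rw [insert_subset_iff, singleton_subset_iff]; exact ⟨by simp [hn'], h5⟩)
  have h0 := costLE_divisors_fifteen (f := f) (B := B) Nat.prime_two hC hα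
  rw [hm0] at h0
  rw [hm0, hh, sum_pair (by decide)] at h2
  refine costLE_of_sel (fun i _ => ?_) h0 h2 ?_
  · simp only [mem_insert, mem_singleton]
    rw [ordCompl_three_eq_iff_of_dvd (c := 1) (by norm_num) h3 (hN _),
      ordCompl_three_eq_iff_of_dvd (c := 5) (by norm_num) h3 (hN _)]
    norm_num
    tauto
  · norm_num
    linarith

theorem costLE_of_not_seven_eleven {m : ℚ} (hm0 : 1 - 1 / ((2 : ℕ) : ℚ) ^ α = m)
    (hC : SmallTorsion C 2) (hα : ∀ i ∈ B, 2 ^ α • (f i).2 = 0)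
    (hβ : ∀ d, beta f B d ≤ m) (hV : beta f B 1 ≤ m - 1 / 2) (h3 : ¬ 3 ∣ n')
    (hN : ∀ g : G, addOrderOf g ∣ 3 * n') {h : ℚ} (hh : ∑ c ∈ n'.divisors, 1 / (c : ℚ) = h)
    (hm1 : m ≤ 1) (hle : beta f B 1 + beta f B 3 ≤ m) (h5 : 5 ∈ n'.divisors)
    (hle5 : beta f B 1 + beta f B 5 ≤ m) (h25 : 25 ∈ n'.divisors)
    (hm : m * (h - 1) ≤ m * (269 / 576)) : CostLE f B m := by
  have hn' : n' ≠ 0 := fun h => h3 (h ▸ dvd_zero 3)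
  have h2 := costLE_lines (a := 1) Nat.prime_two hC hα (hm0 ▸ hβ) Nat.prime_three h3 hN
    (X := {1, 5, 25}) (by
      rw [insert_subset_iff, insert_subset_iff, singleton_subset_iff]
      exact ⟨by simp [hn'], h5, h25⟩)
  have h0 := costLE_divisors_seventy_five (f := f) (B := B) Nat.prime_two hC hα
  rw [hm0] at h0
  rw [hm0, hh, sum_insert (by decide), sum_pair (by decide)] at h2
  refine costLE_of_sel (fun i _ => ?_) h0 h2 ?_
  · simp only [mem_insert, mem_singleton]
    rw [ordCompl_three_eq_iff_of_dvd (c := 1) (by norm_num) h3 (hN _),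
      ordCompl_three_eq_iff_of_dvd (c := 5) (by norm_num) h3 (hN _),
      ordCompl_three_eq_iff_of_dvd (c := 25) (by norm_num) h3 (hN _)]
    norm_num
    tauto
  · have := hβ 25
    norm_num
    linarith

/-- Here `25` and `11` take over the role of `7`: the divisors of `75` share one chain, and `11`,
`33` are packed at `33`. -/
theorem costLE_of_eleven {m : ℚ} (hm0 : 1 - 1 / ((2 : ℕ) : ℚ) ^ α = m)
    (hC : SmallTorsion C 2) (hα : ∀ i ∈ B, 2 ^ α • (f i).2 = 0)
    (hβ : ∀ d, beta f B d ≤ m) (hV : beta f B 1 ≤ m - 1 / 2) (h3 : ¬ 3 ∣ n')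
    (hN : ∀ g : G, addOrderOf g ∣ 3 * n') {h : ℚ} (hh : ∑ c ∈ n'.divisors, 1 / (c : ℚ) = h)
    (hm1 : m ≤ 1) (hle : beta f B 1 + beta f B 3 ≤ m) (h5 : 5 ∈ n'.divisors)
    (hle5 : beta f B 1 + beta f B 5 ≤ m) (h25 : 25 ∈ n'.divisors) (h11 : 11 ∈ n'.divisors)
    (hle11 : beta f B 1 + beta f B 11 ≤ m) (hm : m * (h - 1) ≤ m * (1 / 2)) :
    CostLE f B m := by
  have hn' : n' ≠ 0 := fun h => h3 (h ▸ dvd_zero 3)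
  have h2 := costLE_lines (a := 1) Nat.prime_two hC hα (hm0 ▸ hβ) Nat.prime_three h3 hN
    (X := {1, 5, 25, 11}) (by
      rw [insert_subset_iff, insert_subset_iff, insert_subset_iff, singleton_subset_iff]
      exact ⟨by simp [hn'], h5, h25, h11⟩)
  have h1 := costLE_sel (f := f) (B := B) (P := (· ∈ ({11, 33} : Finset ℕ)))
    (D := fun k => 33) (st := fun d => 0) Nat.prime_two hC hα (by simp) (by simp) (by decide)
    {11, 33} (by simp) (fun d h1 h2 => absurd h1 h2)
  have h0 := costLE_divisors_seventy_five (f := f) (B := B) Nat.prime_two hC hα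
  rw [hm0] at h0 h1
  rw [sum_pair (by decide)] at h1
  rw [hm0, hh, sum_insert (by decide), sum_insert (by decide), sum_pair (by decide)] at h2
  refine costLE_of_sel (fun i _ => ?_) (costLE_sel_or h0 h1 ?_) h2 ?_
  · simp only [mem_insert, mem_singleton]
    rw [ordCompl_three_eq_iff_of_dvd (c := 1) (by norm_num) h3 (hN _),
      ordCompl_three_eq_iff_of_dvd (c := 5) (by norm_num) h3 (hN _),
      ordCompl_three_eq_iff_of_dvd (c := 25) (by norm_num) h3 (hN _),
      ordCompl_three_eq_iff_of_dvd (c := 11) (by norm_num) h3 (hN _)]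
    norm_num
    tauto
  · decide
  · have := hβ 25
    norm_num
    linarith

end Five

/-- Whenever `β 1 + β c > m` for one of the relevant `c`, a zero sum of order dividing `c` is
guaranteed and saves enough. When `β 1 + β c ≤ m`, the line of `c` has slack instead. If a small
prime is missing from `n'`, the sum of the `1 / c` is smaller and fewer lines need care. -/
theorem packable_two_three.{u} {G C : Type*} [AddCommGroup G] [AddCommGroup C] {n' a : ℕ}
    (hC : SmallTorsion C 2) (h3 : ¬ 3 ∣ n') (hN : ∀ g : G, addOrderOf g ∣ 3 ^ a * n')
    (hb : DivisorBounds n' a (∑ c ∈ n'.divisors, 1 / (c : ℚ))) : Packable.{u} G C 2 := by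
  classical
  intro α ι B f hα hβ hV
  have hn' : n' ≠ 0 := fun h => h3 (h ▸ dvd_zero 3)
  obtain ⟨m, hm0⟩ : ∃ m, 1 - 1 / ((2 : ℕ) : ℚ) ^ α = m := ⟨_, rfl⟩
  obtain ⟨h, hh⟩ : ∃ h, ∑ c ∈ n'.divisors, 1 / (c : ℚ) = h := ⟨_, rfl⟩
  rw [hh] at hb
  rw [hm0] at hβ hV ⊢
  change ∀ d, beta f B d ≤ m at hβ
  change beta f B 1 ≤ m - 1 / 2 at hV
  have hm1 : m ≤ 1 := by
    rw [← hm0, sub_le_self_iff]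
    positivity
  have hm2 : 0 ≤ m := (beta_nonneg f B 1).trans (hβ 1)
  have key : ∀ {b : ℚ}, h ≤ 1 + b → m * (h - 1) ≤ m * b := fun hb =>
    mul_le_mul_of_nonneg_left (by linarith) hm2
  have key' : ∀ {b : ℚ}, 0 ≤ b → h ≤ 1 + b → m * (h - 1) ≤ b := fun hb0 hb =>
    (key hb).trans (mul_le_of_le_one_left hb0 hm1)
  have hmem : ∀ {c}, c ∣ n' → c ∈ n'.divisors := fun hc => Nat.mem_divisors.2 ⟨hc, hn'⟩
  rcases lt_or_ge m (beta f B 1 + beta f B 3) with hy | hy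
  · by_cases ha : a = 1
    · subst ha
      exact costLE_of_three_large_of_exp_one hm0 hC hα hβ hV h3 hN hh hm1 hy
        (key (by linarith [hb.one rfl]))
    · exact costLE_of_three_large hm0 hC hα hβ hV h3 hN hh hm1 hy (key (by linarith [hb.two ha]))
  by_cases h5 : 5 ∣ n'
  swap
  · by_cases h7 : 7 ∣ n'
    · exact costLE_of_second_line hm0 hC hα hβ hV h3 hN hh hm1 hy (hmem h7)
        (Or.inr ⟨rfl, key (by linarith [hb.not_five h5])⟩)
    · exact costLE_one_line hm0 hC hα hβ hV h3 hN hh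
        (key' (by norm_num) (by linarith [hb.not_five_seven h5 h7]))
  by_cases ha : a = 1
  swap
  · exact costLE_of_second_line hm0 hC hα hβ hV h3 hN hh hm1 hy (hmem h5)
      (Or.inl ⟨rfl, key (by linarith [hb.two ha])⟩)
  subst ha
  rw [pow_one] at hN
  have hs : m * (h - 1) ≤ m * (1 / 2) := key (by linarith [hb.one rfl])
  rcases lt_or_ge m (beta f B 1 + beta f B 5) with hz | hz
  · exact costLE_of_five_large hm0 hC hα hβ hV h3 hN hh hm1 hy (hmem h5) hz hs
  by_cases h7 : 7 ∣ n'
  · rcases lt_or_ge m (beta f B 1 + beta f B 7) with hw | hw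
    · exact costLE_of_seven_or_eleven_large hm0 hC hα hβ hV h3 hN hh hm1 hy (hmem h5) hz
        (Or.inl rfl) (hmem h7) hw hs
    · exact costLE_of_seven hm0 hC hα hβ hV h3 hN hh hm1 hy (hmem h5) hz (hmem h7) hw hs
  by_cases h25 : 25 ∣ n'
  swap
  · exact costLE_of_not_seven_twenty_five hm0 hC hα hβ hV h3 hN hh hm1 hy (hmem h5) hz
      (key (by linarith [hb.not_seven_twenty_five h7 h25]))
  by_cases h11 : 11 ∣ n'
  swap
  · exact costLE_of_not_seven_eleven hm0 hC hα hβ hV h3 hN hh hm1 hy (hmem h5) hz (hmem h25)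
      (key (by linarith [hb.not_seven_eleven h7 h11]))
  rcases lt_or_ge m (beta f B 1 + beta f B 11) with hw | hw
  · exact costLE_of_seven_or_eleven_large hm0 hC hα hβ hV h3 hN hh hm1 hy (hmem h5) hz
      (Or.inr rfl) (hmem h11) hw hs
  · exact costLE_of_eleven hm0 hC hα hβ hV h3 hN hh hm1 hy (hmem h5) hz (hmem h25) (hmem h11) hw hs

/-! ### The group algebra bound for `q`-groups -/

section GroupAlgebra

/-- The ideal generated by the monomials in `x` of weight at least `W`. -/
def weightIdeal {κ R : Type*} [Fintype κ] [CommRing R] (x : κ → R) (w : κ → ℕ) (W : ℕ) : Ideal R :=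
  Ideal.span {z | ∃ n : κ → ℕ, W ≤ ∑ j, n j * w j ∧ z = ∏ j, x j ^ n j}

variable {κ R : Type*} [Fintype κ] [CommRing R] {x : κ → R} {w : κ → ℕ}

theorem mul_mem_weightIdeal {W W' : ℕ} {y z : R} (hy : y ∈ weightIdeal x w W)
    (hz : z ∈ weightIdeal x w W') : y * z ∈ weightIdeal x w (W + W') := by
  have h : weightIdeal x w W * weightIdeal x w W' ≤ weightIdeal x w (W + W') := by
    rw [weightIdeal, weightIdeal, Ideal.span_mul_span']
    refine Ideal.span_mono ?_
    rintro _ ⟨_, ⟨n, hn, rfl⟩, _, ⟨n', hn', rfl⟩, rfl⟩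
    refine ⟨n + n', ?_, ?_⟩
    · simp only [Pi.add_apply, add_mul, sum_add_distrib]
      omega
    · simp only [Pi.add_apply, pow_add, prod_mul_distrib]
  exact h (Ideal.mul_mem_mul hy hz)

theorem prod_mem_weightIdeal {ι : Type*} (s : Finset ι) (W : ι → ℕ) (y : ι → R)
    (h : ∀ i ∈ s, y i ∈ weightIdeal x w (W i)) :
    ∏ i ∈ s, y i ∈ weightIdeal x w (∑ i ∈ s, W i) := by
  classical
  induction s using Finset.induction_on with
  | empty =>
    simp only [prod_empty, sum_empty]
    exact Ideal.subset_span ⟨0, by simp⟩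
  | insert i s hi ih =>
    rw [prod_insert hi, sum_insert hi]
    exact mul_mem_weightIdeal (h i (mem_insert_self _ _))
      (ih fun j hj => h j (mem_insert_of_mem hj))

theorem pow_mem_weightIdeal (j : κ) (n : ℕ) {W : ℕ} (h : W ≤ n * w j) :
    x j ^ n ∈ weightIdeal x w W := by
  classical
  refine Ideal.subset_span ⟨Pi.single j n, ?_, ?_⟩
  · rw [sum_eq_single j (fun k _ hk => by simp [Pi.single_eq_of_ne hk]) (by simp)]
    simpa using h
  · rw [prod_eq_single j (fun k _ hk => by simp [Pi.single_eq_of_ne hk]) (by simp)]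
    simp

/-- A monomial with all exponents `n j < N j` is too light, so every generator contains some
vanishing power `x j ^ N j`. -/
theorem weightIdeal_eq_bot {N : κ → ℕ} (hx : ∀ j, x j ^ N j = 0) {W : ℕ}
    (hW : ∑ j, (N j - 1) * w j < W) : weightIdeal x w W = ⊥ := by
  rw [weightIdeal, Ideal.span_eq_bot]
  rintro _ ⟨n, hn, rfl⟩
  obtain ⟨j, hj⟩ : ∃ j, N j ≤ n j := by
    by_contra! h
    have : ∑ j, n j * w j ≤ ∑ j, (N j - 1) * w j :=
      sum_le_sum fun j _ => Nat.mul_le_mul_right _ (by have := h j; omega)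
    omega
  refine prod_eq_zero (mem_univ j) ?_
  rw [← Nat.sub_add_cancel hj, pow_add, hx, mul_zero]

theorem prod_sub_one_mem {ι : Type*} (I : Ideal R) (s : Finset ι) (y : ι → R)
    (h : ∀ i ∈ s, y i - 1 ∈ I) : ∏ i ∈ s, y i - 1 ∈ I := by
  rw [← Ideal.Quotient.mk_eq_mk_iff_sub_mem, map_prod, map_one]
  refine prod_eq_one fun i hi => ?_
  rw [← map_one (Ideal.Quotient.mk I)]
  exact (Ideal.Quotient.mk_eq_mk_iff_sub_mem _ _).2 (h i hi)

/-- In the expanded product only the empty subfamily contributes to the coefficient at `0`, which is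
therefore `±1`. -/
theorem ZeroSumFree.prod_single_sub_one_ne_zero {ι G K : Type*} [AddCommGroup G] [Field K]
    {s : Finset ι} {f : ι → G} (h : ZeroSumFree s f) :
    ∏ i ∈ s, (AddMonoidAlgebra.single (f i) (1 : K) - 1) ≠ 0 := by
  classical
  intro h0
  have h1 : ∀ i ∈ s, AddMonoidAlgebra.single (f i) (1 : K) - 1
      = AddMonoidAlgebra.single (f i) 1 + AddMonoidAlgebra.single 0 (-1) := fun i _ => by
    rw [AddMonoidAlgebra.one_def, AddMonoidAlgebra.single_neg, sub_eq_add_neg]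
  rw [prod_congr rfl h1, prod_add] at h0
  have h2 := congrArg (fun z : AddMonoidAlgebra K G => z.coeff 0) h0
  simp only [AddMonoidAlgebra.prod_single, AddMonoidAlgebra.single_mul_single, sum_const_zero,
    add_zero, AddMonoidAlgebra.coeff_sum, AddMonoidAlgebra.coeff_single, Finsupp.finsetSum_apply,
    AddMonoidAlgebra.coeff_zero, Finsupp.zero_apply, prod_const_one, one_mul] at h2
  rw [sum_eq_single ∅ ?_ (by simp)] at h2
  · simp at h2
  · intro t ht hne
    exact Finsupp.single_eq_of_ne' (h t (mem_powerset.1 ht) (nonempty_iff_ne_empty.2 hne))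

end GroupAlgebra

section Bound

variable {κ R : Type*} [Fintype κ] [CommRing R]

/-- In characteristic `q`, `y ^ q ^ k - 1 = (y - 1) ^ q ^ k`, and this divides `y ^ (q ^ k * u) -
1`. -/
theorem pow_sub_one_mem_weightIdeal {q : ℕ} [Fact q.Prime] [CharP R q] (w : κ → ℕ)
    (y : κ → R) (j : κ) (k u : ℕ) {W : ℕ} (h : W ≤ q ^ k * w j) :
    y j ^ (q ^ k * u) - 1 ∈ weightIdeal (fun j => y j - 1) w W := by
  have h1 : y j ^ q ^ k - 1 ∣ y j ^ (q ^ k * u) - 1 := by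
    rw [pow_mul]
    exact sub_one_dvd_pow_sub_one _ u
  refine Ideal.mem_of_dvd _ h1 ?_
  have h2 : y j ^ q ^ k - 1 = (y j - 1) ^ q ^ k := by
    rw [sub_pow_char_pow, one_pow]
  rw [h2]
  exact pow_mem_weightIdeal (x := fun j => y j - 1) j _ h

end Bound

theorem single_sub_one_mem_weightIdeal {κ : Type*} [Fintype κ] {q : ℕ} [Fact q.Prime] (a : κ → ℕ)
    [DecidableEq κ] (g : ∀ j, ZMod (q ^ a j)) {b E : ℕ} (hE : ∀ j, a j ≤ E) (hb : q ^ b • g = 0) :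
    (AddMonoidAlgebra.single g (1 : ZMod q) - 1) ∈ weightIdeal
      (fun j => AddMonoidAlgebra.single (Pi.single j 1 : ∀ j, ZMod (q ^ a j)) (1 : ZMod q) - 1)
      (fun j => q ^ (E - a j)) (q ^ (E - b)) := by
  have hq : q.Prime := Fact.out
  have : ∀ j, NeZero (q ^ a j) := fun j => ⟨pow_ne_zero _ hq.ne_zero⟩
  have : CharP (AddMonoidAlgebra (ZMod q) (∀ j, ZMod (q ^ a j))) q :=
    charP_of_injective_algebraMap
      (algebraMap (ZMod q) (AddMonoidAlgebra (ZMod q) (∀ j, ZMod (q ^ a j)))).injective q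
  have hg : AddMonoidAlgebra.single g (1 : ZMod q) = ∏ j, AddMonoidAlgebra.single
      (Pi.single j 1 : ∀ j, ZMod (q ^ a j)) (1 : ZMod q) ^ (g j).val := by
    simp only [AddMonoidAlgebra.single_pow, one_pow, AddMonoidAlgebra.prod_single, prod_const_one]
    congr 1
    ext k
    rw [Finset.sum_apply, sum_eq_single k]
    · simp
    · intro j _ hj
      simp [Pi.single_eq_of_ne' hj]
    · simp
  rw [hg]
  refine prod_sub_one_mem _ _ _ fun j _ => ?_
  -- An element killed by `q ^ b` has all coordinates divisible by `q ^ (a j - b)`. The `j`-th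
  -- generator has weight `q ^ (E - a j)`, so each factor reaches weight `q ^ (E - b)`.
  have hdvd : q ^ (a j - b) ∣ (g j).val := by
    have h1 : ((q ^ b * (g j).val : ℕ) : ZMod (q ^ a j)) = 0 := by
      have := congrFun hb j
      rw [Pi.smul_apply, nsmul_eq_mul] at this
      rw [Nat.cast_mul, ZMod.natCast_zmod_val]
      exact this
    rw [ZMod.natCast_eq_zero_iff] at h1
    rcases le_total (a j) b with hab | hab
    · simp [Nat.sub_eq_zero_of_le hab]
    refine Nat.dvd_of_mul_dvd_mul_left (pow_pos hq.pos b) (Dvd.dvd.trans ?_ h1)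
    rw [← pow_add]
    exact pow_dvd_pow q (by omega)
  obtain ⟨u, hu⟩ := hdvd
  rw [hu]
  refine pow_sub_one_mem_weightIdeal (fun j => q ^ (E - a j))
    (fun j => AddMonoidAlgebra.single (Pi.single j 1 : ∀ j, ZMod (q ^ a j)) (1 : ZMod q)) j _ u ?_
  rw [← pow_add]
  refine Nat.pow_le_pow_right hq.pos ?_
  have := hE j
  omega

/-- The cross number of a finite abelian `q`-group. -/
theorem crossBound_pi_zmod_pow {κ : Type*} [Fintype κ] {q : ℕ} (hq : q.Prime) (a : κ → ℕ) :
    CrossBound (∀ j, ZMod (q ^ a j)) (∑ j, (1 - 1 / (q : ℚ) ^ a j)) := by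
  classical
  have : Fact q.Prime := ⟨hq⟩
  intro ι s f h
  have hq0 : (0 : ℚ) < q := by exact_mod_cast hq.pos
  -- Any common bound for the exponents would do; it turns the inverse orders into integer weights
  -- `q ^ (E - b i)`.
  set E := ∑ j, a j with hEdef
  have hE : ∀ j, a j ≤ E := fun j => single_le_sum (fun _ _ => Nat.zero_le _) (mem_univ j)
  have hord : ∀ i, ∃ b ≤ E, addOrderOf (f i) = q ^ b := by
    intro i
    refine (Nat.dvd_prime_pow hq).1 (addOrderOf_dvd_of_nsmul_eq_zero ?_)
    ext j
    have : ((q ^ E : ℕ) : ZMod (q ^ a j)) = 0 :=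
      (ZMod.natCast_eq_zero_iff _ _).2 (pow_dvd_pow q (hE j))
    rw [Pi.smul_apply, nsmul_eq_mul, this, zero_mul, Pi.zero_apply]
  choose b hbE hb using hord
  have hmem := prod_mem_weightIdeal s (fun i => q ^ (E - b i)) _ fun i _ =>
    single_sub_one_mem_weightIdeal a (f i) hE (b := b i) (by rw [← hb i]; exact addOrderOf_nsmul_eq_zero _)
  have hle : ∑ i ∈ s, q ^ (E - b i) ≤ ∑ j, (q ^ a j - 1) * q ^ (E - a j) := by
    by_contra! hlt
    rw [weightIdeal_eq_bot (N := fun j => q ^ a j) ?_ hlt, Ideal.mem_bot] at hmem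
    · exact h.prod_single_sub_one_ne_zero hmem
    · intro j
      have : CharP (AddMonoidAlgebra (ZMod q) (∀ j, ZMod (q ^ a j))) q :=
        charP_of_injective_algebraMap
          (algebraMap (ZMod q) (AddMonoidAlgebra (ZMod q) (∀ j, ZMod (q ^ a j)))).injective q
      have : q ^ a j • (Pi.single j 1 : ∀ j, ZMod (q ^ a j)) = 0 := by
        rw [← Pi.single_smul, nsmul_eq_mul, ZMod.natCast_self, zero_mul, Pi.single_zero]
      rw [sub_pow_char_pow, one_pow, AddMonoidAlgebra.single_pow, one_pow, this,
        AddMonoidAlgebra.one_def, sub_self]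
  have hle' : ∑ i ∈ s, (q : ℚ) ^ (E - b i) ≤ ∑ j, ((q : ℚ) ^ a j - 1) * (q : ℚ) ^ (E - a j) := by
    have := (Nat.cast_le (α := ℚ)).2 hle
    push_cast at this
    refine this.trans (le_of_eq (sum_congr rfl fun j _ => ?_))
    rw [Nat.cast_sub (Nat.one_le_pow _ _ hq.pos)]
    push_cast
    rfl
  have e1 : ∀ {c}, c ≤ E → (q : ℚ) ^ (E - c) = (q : ℚ) ^ E * (1 / (q : ℚ) ^ c) := fun hc => by
    rw [pow_sub₀ _ hq0.ne' hc, one_div]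
  have e2 : ∑ i ∈ s, (q : ℚ) ^ (E - b i) = (q : ℚ) ^ E * crossNum s f := by
    rw [crossNum, mul_sum]
    refine sum_congr rfl fun i _ => ?_
    rw [e1 (hbE i), hb i, Nat.cast_pow]
  have e3 : ∑ j, ((q : ℚ) ^ a j - 1) * (q : ℚ) ^ (E - a j)
      = (q : ℚ) ^ E * ∑ j, (1 - 1 / (q : ℚ) ^ a j) := by
    rw [mul_sum]
    refine sum_congr rfl fun j _ => ?_
    rw [e1 (hE j)]
    field_simp
  rw [e2, e3] at hle'
  exact le_of_mul_le_mul_left hle' (pow_pos hq0 E)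

/-! ### Wideness and sums of inverse divisors -/

/-- The sum of the inverses of the divisors of `n`. -/
def divSum (n : ℕ) : ℚ := ∑ c ∈ n.divisors, 1 / (c : ℚ)

theorem divSum_one : divSum 1 = 1 := by simp [divSum]

theorem one_le_divSum {n : ℕ} (hn : n ≠ 0) : 1 ≤ divSum n := by
  have := sum_le_sum_of_subset_of_nonneg (s := {1}) (t := n.divisors) (by simp [hn])
    (f := fun c : ℕ => 1 / (c : ℚ)) (fun _ _ _ => by positivity)
  simpa [divSum] using this

theorem divSum_eq {n : ℕ} (hn : n ≠ 0) : divSum n = (∑ d ∈ n.divisors, d : ℕ) / n := by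
  rw [divSum, ← Nat.sum_div_divisors n fun d => 1 / (d : ℚ), Nat.cast_sum, sum_div]
  refine sum_congr rfl fun d hd => ?_
  have hd' := Nat.dvd_of_mem_divisors hd
  have hd0 : (d : ℚ) ≠ 0 := by
    exact_mod_cast fun h : d = 0 => hn (zero_dvd_iff.1 (h ▸ hd'))
  rw [Nat.cast_div hd' hd0, one_div_div]

theorem divSum_mul {m n : ℕ} (h : m.Coprime n) : divSum (m * n) = divSum m * divSum n := by
  rcases eq_or_ne m 0 with rfl | hm
  · simp [divSum]
  rcases eq_or_ne n 0 with rfl | hn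
  · simp [divSum]
  rw [divSum_eq hm, divSum_eq hn, divSum_eq (mul_ne_zero hm hn), h.sum_divisors_mul,
    div_mul_div_comm]
  push_cast
  rfl

theorem divSum_prime_pow {q : ℕ} (hq : q.Prime) (a : ℕ) :
    divSum (q ^ a) = ((q : ℚ) ^ (a + 1) - 1) / ((q : ℚ) ^ (a + 1) - (q : ℚ) ^ a) := by
  have h1 : (1 : ℚ) < q := by exact_mod_cast hq.one_lt
  have h2 : (q : ℚ) - 1 ≠ 0 := by linarith
  rw [divSum, Nat.sum_divisors_prime_pow hq]
  induction a with
  | zero =>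
    simp
    rw [div_self h2]
  | succ a ih =>
    rw [sum_range_succ, ih, pow_succ _ (a + 1), pow_succ _ a]
    push_cast
    field_simp
    ring

theorem divSum_prime_pow_le {q : ℕ} (hq : q.Prime) (a : ℕ) :
    divSum (q ^ a) ≤ (q : ℚ) / (q - 1) := by
  have h1 : (1 : ℚ) < q := by exact_mod_cast hq.one_lt
  have h2 : 0 < (q : ℚ) - 1 := by linarith
  have h3 : (q : ℚ) ^ (a + 1) - (q : ℚ) ^ a = (q - 1) * (q : ℚ) ^ a := by ring
  rw [divSum_prime_pow hq, h3, div_le_div_iff₀ (by positivity) h2]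
  ring_nf
  nlinarith

theorem prod_primeFactors_eq_divSum {n : ℕ} (hn : n ≠ 0) :
    ∏ q ∈ n.primeFactors, ((q : ℚ) ^ (n.factorization q + 1) - 1) /
      ((q : ℚ) ^ (n.factorization q + 1) - (q : ℚ) ^ n.factorization q) = divSum n := by
  rw [Nat.multiplicative_factorization divSum (fun _ _ h => divSum_mul h) divSum_one hn,
    Finsupp.prod, Nat.support_factorization]
  exact prod_congr rfl fun q hq => (divSum_prime_pow (Nat.prime_of_mem_primeFactors hq) _).symm

theorem divSum_le_of_primeWide {p n : ℕ} (h : PrimeWide p n) (hn : n ≠ 0) :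
    divSum n ≤ (p : ℚ) / (p - 1) := by
  rw [← prod_primeFactors_eq_divSum hn]
  exact h.2

/-- The part of `n` composed of the primes greater than `P`. -/
def tail (n P : ℕ) : ℕ := ∏ q ∈ n.primeFactors with P < q, q ^ n.factorization q

theorem tail_ne_zero (n P : ℕ) : tail n P ≠ 0 :=
  prod_ne_zero_iff.2 fun _ hq =>
    pow_ne_zero _ (Nat.prime_of_mem_primeFactors (mem_filter.1 hq).1).ne_zero

theorem prime_dvd_tail_iff {n P r : ℕ} (hr : r.Prime) :
    r ∣ tail n P ↔ r ∈ n.primeFactors ∧ P < r := by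
  rw [tail, hr.prime.dvd_finsetProd_iff]
  constructor
  · rintro ⟨q, hq, h⟩
    obtain ⟨h1, h2⟩ := mem_filter.1 hq
    rw [(Nat.prime_dvd_prime_iff_eq hr (Nat.prime_of_mem_primeFactors h1)).1
      (hr.dvd_of_dvd_pow h)]
    exact ⟨h1, h2⟩
  · rintro ⟨h1, h2⟩
    refine ⟨r, mem_filter.2 ⟨h1, h2⟩, dvd_pow_self r ?_⟩
    exact Nat.one_le_iff_ne_zero.1 ((hr.dvd_iff_one_le_factorization
      (Nat.mem_primeFactors.1 h1).2.2).1 (Nat.dvd_of_mem_primeFactors h1))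

theorem pow_dvd_tail {n P q a : ℕ} (hq : q.Prime) (hn : n ≠ 0) (hP : P < q) (h : q ^ a ∣ n) :
    q ^ a ∣ tail n P := by
  rcases Nat.eq_zero_or_pos a with rfl | ha
  · simp
  have hqn : q ∈ n.primeFactors :=
    Nat.mem_primeFactors.2 ⟨hq, (dvd_pow_self q ha.ne').trans h, hn⟩
  exact (pow_dvd_pow q ((hq.pow_dvd_iff_le_factorization hn).1 h)).trans
    (dvd_prod_of_mem (fun q => q ^ n.factorization q) (mem_filter.2 ⟨hqn, hP⟩))

theorem tail_eq_one {n P : ℕ} (h : ∀ q ∈ n.primeFactors, q ≤ P) : tail n P = 1 := by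
  rw [tail, filter_false_of_mem (fun q hq => not_lt.2 (h q hq)), prod_empty]

theorem tail_eq_mul {n P q : ℕ} (hq : q ∈ n.primeFactors) (hP : P < q)
    (hmin : ∀ r ∈ n.primeFactors, P < r → q ≤ r) :
    tail n P = q ^ n.factorization q * tail n q := by
  have : (n.primeFactors.filter fun r => P < r)
      = insert q (n.primeFactors.filter fun r => q < r) := by
    ext r
    simp only [mem_filter, mem_insert]
    constructor
    · rintro ⟨h1, h2⟩
      rcases (hmin r h1 h2).eq_or_lt with h | h
      · exact Or.inl h.symm
      · exact Or.inr ⟨h1, h⟩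
    · rintro (rfl | ⟨h1, h2⟩)
      · exact ⟨hq, hP⟩
      · exact ⟨h1, hP.trans h2⟩
  rw [tail, this, prod_insert (by simp), tail]

theorem exists_next_prime {n P : ℕ} (h : ∃ q ∈ n.primeFactors, P < q) :
    ∃ q ∈ n.primeFactors, P < q ∧ ∀ r ∈ n.primeFactors, P < r → q ≤ r := by
  obtain ⟨q, hq, hP⟩ := h
  have hne : (n.primeFactors.filter fun r => P < r).Nonempty := ⟨q, mem_filter.2 ⟨hq, hP⟩⟩
  have h1 := mem_filter.1 (min'_mem _ hne)
  exact ⟨_, h1.1, h1.2, fun r hr hPr => min'_le _ _ (mem_filter.2 ⟨hr, hPr⟩)⟩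

theorem divSum_tail_mul {n q : ℕ} (hq : q ∈ n.primeFactors) :
    divSum (q ^ n.factorization q * tail n q) = divSum (q ^ n.factorization q) * divSum (tail n q) := by
  have hq' := Nat.prime_of_mem_primeFactors hq
  refine divSum_mul (Nat.Coprime.pow_left _ ((Nat.Prime.coprime_iff_not_dvd hq').2 ?_))
  rw [prime_dvd_tail_iff hq']
  simp

theorem le_largestPrimeFactor {n q : ℕ} (hq : q ∈ n.primeFactors) : q ≤ largestPrimeFactor n :=
  le_sup (f := id) hq

theorem divSum_tail_le {n q : ℕ} (h : Wide n) (hq : q ∈ n.primeFactors) :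
    divSum (tail n q) ≤ (q : ℚ) / (q - 1) := by
  by_cases hl : q = largestPrimeFactor n
  · rw [tail_eq_one fun r hr => hl ▸ le_largestPrimeFactor hr, divSum_one]
    have h1 : (1 : ℚ) < q := by exact_mod_cast (Nat.prime_of_mem_primeFactors hq).one_lt
    rw [le_div_iff₀ (by linarith)]
    linarith
  · exact divSum_le_of_primeWide (n := tail n q) (h q hq hl) (tail_ne_zero n q)

theorem div_sub_one_le {x y : ℚ} (hx : 1 < x) (hxy : x ≤ y) : y / (y - 1) ≤ x / (x - 1) := by
  rw [div_le_div_iff₀ (by linarith) (by linarith)]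
  linarith

/-- For the least prime `q > P` of `n`, the power of `q` contributes at most `q / (q - 1)`, and by
wideness at `q` so does everything above `q`. This quantity decreases in `q`. -/
theorem divSum_tail_le_sq {n P r : ℕ} (h : Wide n) (hr : 1 < r)
    (hmin : ∀ q ∈ n.primeFactors, P < q → r ≤ q) :
    divSum (tail n P) ≤ ((r : ℚ) / (r - 1)) ^ 2 := by
  have hr' : (1 : ℚ) < r := by exact_mod_cast hr
  by_cases hex : ∃ q ∈ n.primeFactors, P < q
  · obtain ⟨q, hq, hP, hq'⟩ := exists_next_prime hex
    have hle := div_sub_one_le hr' (by exact_mod_cast hmin q hq hP : (r : ℚ) ≤ q)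
    rw [tail_eq_mul hq hP hq', divSum_tail_mul hq, sq]
    refine mul_le_mul ((divSum_prime_pow_le (Nat.prime_of_mem_primeFactors hq) _).trans hle)
      ((divSum_tail_le h hq).trans hle) (zero_le_one.trans (one_le_divSum (tail_ne_zero _ _))) ?_
    exact div_nonneg (by linarith) (by linarith)
  · push Not at hex
    rw [tail_eq_one hex, divSum_one]
    refine one_le_pow₀ ?_
    rw [le_div_iff₀ (by linarith)]
    linarith

/-- Wideness at `3` gives `3 / 2`. If `9 ∣ n`, dividing the bound `2` by `1 + 1/3 + 1/9 = 13/9`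
gives `18 / 13`. The other constants are `(7/6)^2`, `(11/10)^2`, `(6/5) * (11/10)^2` and `(5/4) *
(13/12)^2`, read off from the smallest primes still possible. -/
theorem divisorBounds_tail {n : ℕ} (h : Wide n) (h3 : 3 ∈ n.primeFactors)
    (h2 : divSum (3 ^ n.factorization 3 * tail n 3) ≤ 2) :
    DivisorBounds (tail n 3) (n.factorization 3) (∑ c ∈ (tail n 3).divisors, 1 / (c : ℚ)) := by
  change DivisorBounds (tail n 3) (n.factorization 3) (divSum (tail n 3))
  have hpos : 1 ≤ divSum (tail n 3) := one_le_divSum (tail_ne_zero n 3)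
  have five : 5 ∈ n.primeFactors → tail n 3 = 5 ^ n.factorization 5 * tail n 5 := fun h5 =>
    tail_eq_mul h5 (by norm_num) fun r hr h3r => by
      have hrp := Nat.prime_of_mem_primeFactors hr
      by_contra! hlt
      interval_cases r
      norm_num at hrp
  have hnot : ∀ {c P}, c.Prime → P < c → ¬ c ∣ tail n P → c ∉ n.primeFactors :=
    fun hc hP hd hcn => hd ((prime_dvd_tail_iff hc).2 ⟨hcn, hP⟩)
  have seven : ∀ r ∈ n.primeFactors, 3 < r → r ≠ 5 → 7 ≤ r := by
    intro r hr h3r h5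
    have hrp := Nat.prime_of_mem_primeFactors hr
    by_contra! hlt
    interval_cases r <;> first | omega | norm_num at hrp
  have eleven : ∀ r ∈ n.primeFactors, 3 < r → r ≠ 5 → r ≠ 7 → 11 ≤ r := by
    intro r hr h3r h5 h7
    have hrp := Nat.prime_of_mem_primeFactors hr
    by_contra! hlt
    interval_cases r <;> first | omega | norm_num at hrp
  have thirteen : ∀ r ∈ n.primeFactors, 3 < r → r ≠ 5 → r ≠ 7 → r ≠ 11 → 13 ≤ r := by
    intro r hr h3r h5 h7 h11
    have hrp := Nat.prime_of_mem_primeFactors hr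
    by_contra! hlt
    interval_cases r <;> first | omega | norm_num at hrp
  have ne_of : ∀ {c r}, c ∉ n.primeFactors → r ∈ n.primeFactors → r ≠ c :=
    fun hc hr e => hc (e ▸ hr)
  rw [divSum_tail_mul h3] at h2
  have a0 : 1 ≤ n.factorization 3 :=
    (Nat.prime_three.dvd_iff_one_le_factorization (Nat.mem_primeFactors.1 h3).2.2).1
      (Nat.dvd_of_mem_primeFactors h3)
  refine ⟨fun _ => ?_, fun ha => ?_, fun h5 => ?_, fun h5 h7 => ?_, fun h7 h25 => ?_,
    fun h7 h11 => ?_⟩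
  · have := divSum_tail_le h h3
    norm_num at this
    linarith
  · have h9 : 13 / 9 ≤ divSum (3 ^ n.factorization 3) := by
      rw [divSum, Nat.sum_divisors_prime_pow Nat.prime_three]
      have := sum_le_sum_of_subset_of_nonneg
        (range_subset_range.2 (by omega : 3 ≤ n.factorization 3 + 1))
        (f := fun k => 1 / ((3 ^ k : ℕ) : ℚ)) (fun _ _ _ => by positivity)
      refine le_trans ?_ this
      norm_num [sum_range_succ]
    nlinarith
  · have h5' := hnot Nat.prime_five (by norm_num) h5
    have := divSum_tail_le_sq (P := 3) (r := 7) h (by norm_num)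
      fun r hr h3r => seven r hr h3r (ne_of h5' hr)
    norm_num at this
    linarith
  · have h5' := hnot Nat.prime_five (by norm_num) h5
    have h7' := hnot (by norm_num) (by norm_num) h7
    have := divSum_tail_le_sq (P := 3) (r := 11) h (by norm_num)
      fun r hr h3r => eleven r hr h3r (ne_of h5' hr) (ne_of h7' hr)
    norm_num at this
    linarith
  · have h7' := hnot (by norm_num) (by norm_num) h7
    by_cases h5 : 5 ∈ n.primeFactors
    · have h1 := divSum_tail_le_sq (P := 5) (r := 11) h (by norm_num)
        fun r hr h5r => eleven r hr (by omega) h5r.ne' (ne_of h7' hr)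
      have e := five h5
      have hb : n.factorization 5 = 1 := by
        have h5d : 1 ≤ n.factorization 5 :=
          (Nat.prime_five.dvd_iff_one_le_factorization (Nat.mem_primeFactors.1 h5).2.2).1
            (Nat.dvd_of_mem_primeFactors h5)
        by_contra hb
        refine h25 (Dvd.dvd.trans ?_ (Dvd.intro _ e.symm))
        exact pow_dvd_pow 5 (by omega : 2 ≤ n.factorization 5)
      rw [e, divSum_tail_mul h5, hb, divSum_prime_pow Nat.prime_five]
      norm_num at h1 ⊢
      linarith
    · have := divSum_tail_le_sq (P := 3) (r := 11) h (by norm_num)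
        fun r hr h3r => eleven r hr h3r (ne_of h5 hr) (ne_of h7' hr)
      norm_num at this
      linarith
  · have h7' := hnot (by norm_num) (by norm_num) h7
    have h11' := hnot (by norm_num) (by norm_num) h11
    by_cases h5 : 5 ∈ n.primeFactors
    · have h1 := divSum_tail_le_sq (P := 5) (r := 13) h (by norm_num)
        fun r hr h5r => thirteen r hr (by omega) h5r.ne' (ne_of h7' hr) (ne_of h11' hr)
      rw [five h5, divSum_tail_mul h5]
      have h4 := divSum_prime_pow_le Nat.prime_five (n.factorization 5)
      have h6 : 1 ≤ divSum (tail n 5) := one_le_divSum (tail_ne_zero n 5)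
      norm_num at h1 h4
      nlinarith
    · have := divSum_tail_le_sq (P := 3) (r := 13) h (by norm_num)
        fun r hr h3r => thirteen r hr h3r (ne_of h5 hr) (ne_of h7' hr) (ne_of h11' hr)
      norm_num at this
      linarith

/-- If the next prime `q` is at least `P + 2`, then `P * q ≤ (q - 1) ^ 2`, that is, `1 / (q - 1) ≤
(1 / P) * (1 - 1 / q)`, and wideness at `q` suffices. Otherwise `P = 2` and `q = 3`. -/
theorem packable_tail.{u} {G C : Type*} [AddCommGroup G] [AddCommGroup C] {n P : ℕ} (h : Wide n)
    (hP : P ∈ n.primeFactors) (hl : P ≠ largestPrimeFactor n) (hC : SmallTorsion C P)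
    (hN : ∀ g : G, addOrderOf g ∣ tail n P) : Packable.{u} G C P := by
  have hPp := Nat.prime_of_mem_primeFactors hP
  have hex : ∃ q ∈ n.primeFactors, P < q := by
    by_contra! hex
    refine hl (le_antisymm (le_largestPrimeFactor hP) (Finset.sup_le hex))
  obtain ⟨q, hq, hPq, hmin⟩ := exists_next_prime hex
  have hqp := Nat.prime_of_mem_primeFactors hq
  have hqt : ¬ q ∣ tail n q := by
    rw [prime_dvd_tail_iff hqp]
    simp
  have e := tail_eq_mul hq hPq hmin
  rw [e] at hN
  rcases (Nat.succ_le_of_lt hPq).eq_or_lt with hs | hs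
  · have hP2 : P = 2 := by
      rcases hPp.eq_two_or_odd with h2 | h2
      · exact h2
      rcases hqp.eq_two_or_odd with h3 | h3
      · have := hPp.two_le
        omega
      · omega
    subst hP2
    obtain rfl : q = 3 := hs.symm
    refine packable_two_three hC hqt hN (divisorBounds_tail h hq ?_)
    have := divSum_le_of_primeWide (n := tail n 2) (h 2 hP hl) (tail_ne_zero n 2)
    rw [e] at this
    norm_num at this
    exact this
  · refine packable_of_sum_divisors hPp hC hqp hqt hN ((divSum_tail_le h hq).trans ?_)
    have h1 : (1 : ℚ) < P := by exact_mod_cast hPp.one_lt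
    have h2 : (P : ℚ) + 2 ≤ q := by exact_mod_cast hs
    have h3 : (q : ℚ) / (q - 1) = 1 + 1 / (q - 1) := by
      have : (q : ℚ) - 1 ≠ 0 := by linarith
      field_simp
      ring
    have h4 : 1 / (P : ℚ) * (1 - 1 / q) = (q - 1) / (P * q) := by
      have : (q : ℚ) ≠ 0 := by linarith
      field_simp
    rw [h3, h4, add_le_add_iff_left, div_le_div_iff₀ (by linarith) (by nlinarith)]
    nlinarith

/-- This compares `1 - 1 / P ^ (∑ a j)` with the share of the prime `P` in `k*`, so that no single
index carrying the cyclic component has to be singled out. -/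
theorem one_sub_prod_le_sum {κ : Type*} (s : Finset κ) (x : κ → ℚ) (h0 : ∀ j ∈ s, 0 ≤ x j)
    (h1 : ∀ j ∈ s, x j ≤ 1) : 1 - ∏ j ∈ s, x j ≤ ∑ j ∈ s, (1 - x j) := by
  classical
  induction s using Finset.induction_on with
  | empty => simp
  | insert i s hi ih =>
    rw [prod_insert hi, sum_insert hi]
    have h2 := ih (fun j hj => h0 j (mem_insert_of_mem hj)) fun j hj => h1 j (mem_insert_of_mem hj)
    have h3 : ∏ j ∈ s, x j ≤ 1 :=
      prod_le_one (fun j hj => h0 j (mem_insert_of_mem hj)) fun j hj => h1 j (mem_insert_of_mem hj)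
    nlinarith [h0 i (mem_insert_self _ _), h1 i (mem_insert_self _ _)]

theorem CrossBound.mono.{u, v} {G : Type v} [AddCommGroup G] {c d : ℚ} (h : CrossBound.{u} G c)
    (hcd : c ≤ d) : CrossBound.{u} G d := fun ι s f hf => (h ι s f hf).trans hcd

theorem crossBound_of_subsingleton.{u, v} {G : Type v} [AddCommGroup G] [Subsingleton G] {c : ℚ}
    (hc : 0 ≤ c) : CrossBound.{u} G c := by
  intro ι s f hf
  have : s = ∅ := eq_empty_of_forall_notMem fun i hi => hf.ne_zero hi (Subsingleton.elim _ _)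
  simpa [this, crossNum] using hc

/-! ### Primary parts and the induction over the primes -/

section Pi

/-- The components of `∏ ZMod (p j ^ a j)` for the indices with `Q (p j)`. -/
abbrev Part {ι : Type*} (p a : ι → ℕ) (Q : ℕ → Prop) : Type _ :=
  ∀ j : {j // Q (p j)}, ZMod (p j ^ a j)

variable {ι : Type*} {p a : ι → ℕ}

/-- The restriction to fewer indices. -/
def Part.restrict {Q R : ℕ → Prop} (h : ∀ P, R P → Q P) : Part p a Q →+ Part p a R where
  toFun g j := g ⟨j.1, h _ j.2⟩
  map_zero' := rfl
  map_add' _ _ := rfl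

theorem Part.restrict_injective {Q R : ℕ → Prop} (h : ∀ P, R P → Q P)
    (h' : ∀ j, Q (p j) → ¬ R (p j) → a j = 0) :
    Function.Injective (Part.restrict (p := p) (a := a) h) := by
  intro x y hxy
  funext j
  by_cases hj : R (p j.1)
  · exact congrFun hxy ⟨j.1, hj⟩
  · have : Subsingleton (ZMod (p j.1 ^ a j.1)) := by
      rw [h' j.1 j.2 hj, pow_zero]
      infer_instance
    exact Subsingleton.elim _ _

theorem Part.nsmul_eq_zero {Q : ℕ → Prop} {N : ℕ} (h : ∀ j, Q (p j) → p j ^ a j ∣ N)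
    (g : Part p a Q) : N • g = 0 := by
  funext j
  have : ((N : ℕ) : ZMod (p j.1 ^ a j.1)) = 0 := (ZMod.natCast_eq_zero_iff _ _).2 (h j.1 j.2)
  rw [Pi.smul_apply, nsmul_eq_mul, this, zero_mul, Pi.zero_apply]

variable [Fintype ι]

theorem one_sub_nonneg (hp : ∀ i, (p i).Prime) (j : ι) : 0 ≤ 1 - 1 / (p j : ℚ) ^ a j := by
  have h : (1 : ℚ) ≤ p j := by exact_mod_cast (hp j).one_lt.le
  rw [sub_nonneg, div_le_one (by positivity)]
  exact one_le_pow₀ h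

theorem crossBound_part_eq.{u} {P : ℕ} (hP : P.Prime) :
    CrossBound.{u} (Part p a (· = P)) (∑ j with p j = P, (1 - 1 / (p j : ℚ) ^ a j)) := by
  -- The types `ZMod (p j ^ a j)` depend on `p`, so the whole function `p` is generalized and
  -- replaced by a constant one.
  have key : ∀ {κ : Type _} [Fintype κ] (p a : κ → ℕ), (∀ j, p j = P) →
      CrossBound.{u} (∀ j, ZMod (p j ^ a j)) (∑ j, (1 - 1 / (p j : ℚ) ^ a j)) := by
    intro κ _ p a h
    obtain rfl : p = fun _ => P := funext h
    exact crossBound_pi_zmod_pow hP a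
  refine (key (fun j : {j // p j = P} => p j) (fun j => a j) fun j => j.2).mono (le_of_eq ?_)
  exact (sum_subtype _ (by simp) fun j => 1 - 1 / (p j : ℚ) ^ a j).symm

theorem sum_split (P : ℕ) (F : ι → ℚ) :
    ∑ j with P ≤ p j, F j = ∑ j with P + 1 ≤ p j, F j + ∑ j with p j = P, F j := by
  classical
  rw [← sum_union]
  · refine sum_congr ?_ fun _ _ => rfl
    ext j
    simp only [mem_filter, mem_univ, true_and, mem_union]
    omega
  · refine disjoint_filter.2 fun j _ h1 h2 => ?_
    omega

/-- Downward induction on `P`, with `k` measuring the distance to the largest prime. The part from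
`P` on is trivial beyond that prime, a `P`-group at it, and below it either unchanged or a product
with the cyclic `P`-component. -/
theorem crossBound_part.{u} (hp : ∀ i, (p i).Prime) {n : ℕ} (hn : n ≠ 0) (hw : Wide n)
    (hdvd : ∀ j, p j ^ a j ∣ n)
    (hC : ∀ P : ℕ, P.Prime → P ≠ largestPrimeFactor n → SmallTorsion (Part p a (· = P)) P) (k : ℕ) :
    ∀ P, largestPrimeFactor n < P + k →
      CrossBound.{u} (Part p a (P ≤ ·)) (∑ j with P ≤ p j, (1 - 1 / (p j : ℚ) ^ a j)) := by
  have hmem : ∀ j, a j ≠ 0 → p j ∈ n.primeFactors := fun j hj =>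
    Nat.mem_primeFactors.2 ⟨hp j, (dvd_pow_self _ hj).trans (hdvd j), hn⟩
  have hnn : ∀ s : Finset ι, 0 ≤ ∑ j ∈ s, (1 - 1 / (p j : ℚ) ^ a j) :=
    fun s => sum_nonneg fun j _ => one_sub_nonneg hp j
  induction k with
  | zero =>
    intro P hP
    have : Subsingleton (Part p a (P ≤ ·)) := by
      have : ∀ j : {j // P ≤ p j}, Subsingleton (ZMod (p j ^ a j)) := by
        intro j
        have : a j.1 = 0 := by
          by_contra hj
          have := le_largestPrimeFactor (hmem j.1 hj)
          have := j.2
          omega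
        rw [this, pow_zero]
        infer_instance
      infer_instance
    exact crossBound_of_subsingleton (hnn _)
  | succ k ih =>
    intro P hPk
    have hsplit := sum_split (p := p) P fun j => 1 - 1 / (p j : ℚ) ^ a j
    by_cases hP : P ∈ n.primeFactors
    swap
    · refine CrossBound.of_injective ((ih (P + 1) (by omega)).mono ?_)
        (Part.restrict fun x h => (Nat.le_succ P).trans h) (Part.restrict_injective _ ?_)
      · rw [hsplit]
        exact le_add_of_nonneg_right (hnn _)
      · intro j h1 h2
        by_contra hj
        obtain rfl : p j = P := by omega
        exact hP (hmem j hj)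
    have hPp := Nat.prime_of_mem_primeFactors hP
    by_cases hl : P = largestPrimeFactor n
    · refine CrossBound.of_injective ((crossBound_part_eq (a := a) hPp).mono ?_)
        (Part.restrict fun x h => h.ge) (Part.restrict_injective _ ?_)
      · rw [hsplit]
        exact le_add_of_nonneg_left (hnn _)
      · intro j h1 h2
        by_contra hj
        have := le_largestPrimeFactor (hmem j hj)
        omega
    set C := Part p a (· = P)
    have hN : ∀ g : Part p a (P + 1 ≤ ·), addOrderOf g ∣ tail n P := fun g =>
      addOrderOf_dvd_of_nsmul_eq_zero (Part.nsmul_eq_zero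
        (fun j hj => pow_dvd_tail (hp j) hn (Nat.lt_of_succ_le hj) (hdvd j)) g)
    have hcop : ∀ g : Part p a (P + 1 ≤ ·), (addOrderOf g).Coprime P := fun g => by
      refine Nat.Coprime.coprime_dvd_left (hN g) (Nat.Coprime.symm ?_)
      rw [hPp.coprime_iff_not_dvd, prime_dvd_tail_iff hPp]
      simp
    have hprod : CrossBound.{u} (Part p a (P + 1 ≤ ·) × C)
        (∑ j with P ≤ p j, (1 - 1 / (p j : ℚ) ^ a j)) := by
      intro κ s f hf
      refine (ZeroSumFree.crossNum_prod_le hPp (hC P hPp hl) hcop (ih (P + 1) (by omega))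
        (packable_tail hw hP hl (hC P hPp hl) hN) (∑ j with p j = P, a j) hf ?_).trans ?_
      · intro i _
        refine Part.nsmul_eq_zero (fun j hj => ?_) _
        rw [hj]
        exact pow_dvd_pow P (single_le_sum (f := a) (fun _ _ => Nat.zero_le _) (by simpa using hj))
      · rw [hsplit, add_le_add_iff_left]
        refine le_trans (le_of_eq ?_) (one_sub_prod_le_sum _ (fun j => 1 / (p j : ℚ) ^ a j)
          (fun _ _ => by positivity) fun j _ => by linarith [one_sub_nonneg (a := a) hp j])
        rw [← prod_pow_eq_pow_sum, prod_div_distrib, prod_const_one]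
        congr 2
        exact prod_congr rfl fun j hj => by rw [(mem_filter.1 hj).2]
    refine hprod.of_injective ((Part.restrict fun x h => (Nat.le_succ P).trans h).prod
      (Part.restrict fun x h => h.ge)) ?_
    intro x y hxy
    obtain ⟨h1, h2⟩ := Prod.ext_iff.1 hxy
    funext j
    by_cases hj : p j.1 = P
    · exact congrFun h2 ⟨j.1, hj⟩
    · exact congrFun h1 ⟨j.1, Nat.lt_of_le_of_ne j.2 (Ne.symm hj)⟩

theorem crossBound_pi_zmod.{u} (hp : ∀ i, (p i).Prime) {n : ℕ} (hn : n ≠ 0) (hw : Wide n)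
    (hdvd : ∀ j, p j ^ a j ∣ n)
    (hC : ∀ P : ℕ, P.Prime → P ≠ largestPrimeFactor n → SmallTorsion (Part p a (· = P)) P) :
    CrossBound.{u} (∀ j, ZMod (p j ^ a j)) (kStar p a) := by
  have h := crossBound_part.{_, u} hp hn hw hdvd hC (largestPrimeFactor n + 1) 0 (by omega)
  simp only [Nat.zero_le, filter_true] at h
  refine h.of_injective
    { toFun := fun g j => g j.1, map_zero' := rfl, map_add' := fun _ _ => rfl } ?_
  intro x y hxy
  funext j
  exact congrFun hxy ⟨j, Nat.zero_le _⟩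

/-- Extension by zero. -/
noncomputable def Part.extend (p a : ι → ℕ) (Q : ℕ → Prop) [DecidablePred Q] :
    Part p a Q →+ ∀ j, ZMod (p j ^ a j) where
  toFun g j := if h : Q (p j) then g ⟨j, h⟩ else 0
  map_zero' := by
    funext j
    split_ifs <;> rfl
  map_add' x y := by
    funext j
    simp only [Pi.add_apply]
    split_ifs <;> simp

theorem Part.extend_injective (Q : ℕ → Prop) [DecidablePred Q] :
    Function.Injective (Part.extend p a Q) := by
  intro x y hxy
  funext j
  have := congrFun hxy j.1
  simpa [Part.extend, j.2] using this

/-- The `P`-torsion of `C` embeds in the cyclic primary component of `G`, where `P • x = 0` has at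
most `P` solutions. -/
theorem smallTorsion_of_injective {G C : Type*} [AddCommGroup G] [Finite G] [AddCommGroup C] {P : ℕ}
    [Fact P.Prime] [IsAddCyclic (AddCommGroup.primaryComponent G P)] (φ : C →+ G)
    (hφ : Function.Injective φ) : SmallTorsion C P := by
  classical
  intro F hF
  have hP : P.Prime := Fact.out
  have := Fintype.ofFinite (AddCommGroup.primaryComponent G P)
  have hmem : ∀ x ∈ F, φ x ∈ AddCommGroup.primaryComponent G P := fun x hx => by
    rw [AddCommGroup.mem_primaryComponent]
    exact ⟨1, by rw [pow_one, ← map_nsmul, hF x hx, map_zero]⟩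
  refine le_trans ?_ (IsAddCyclic.card_nsmul_eq_zero_le
    (α := AddCommGroup.primaryComponent G P) hP.pos)
  rw [← card_attach]
  refine card_le_card_of_injOn (fun x => ⟨φ x.1, hmem x.1 x.2⟩) ?_ ?_
  · intro x _
    simp only [coe_filter, mem_univ, true_and, Set.mem_ofPred_eq]
    refine Subtype.ext ?_
    change P • φ x.1 = 0
    rw [← map_nsmul, hF x.1 x.2, map_zero]
  · intro x _ y _ hxy
    exact Subtype.ext (hφ (Subtype.ext_iff.1 hxy))

end Pi

/-! ### Indexed sequences and the lower bound -/

section Sequences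

variable {G : Type*} [AddCommGroup G] {ι : Type*} [Fintype ι] {p a : ι → ℕ}

theorem crossNumber_le_of_crossBound.{u} {G : Type u} [AddCommGroup G] {S : IndexedSeq G}
    (hS : S.IsZeroSumFree) {c : ℚ} (h : CrossBound.{u} G c) : S.crossNumber ≤ c :=
  h ({g : G // g ≠ 0} × ℕ) S (fun x => (x.1 : G)) fun T hT hne => hS T hT hne.ne_empty

theorem addOrderOf_single_one [DecidableEq ι] (m : ι → ℕ) (i : ι) :
    addOrderOf (Pi.single i 1 : ∀ j, ZMod (m j)) = m i := by
  have h := addOrderOf_injective (AddMonoidHom.single (fun j => ZMod (m j)) i)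
    (Pi.single_injective (M := fun j => ZMod (m j)) i) 1
  rw [ZMod.addOrderOf_one] at h
  exact h

/-- The sequence in which the `i`-th basis element is repeated `p i ^ a i - 1` times. -/
theorem exists_crossNumber_eq_kStar (hp : ∀ i, (p i).Prime)
    (e : G ≃+ ∀ j, ZMod (p j ^ a j)) :
    ∃ S : IndexedSeq G, S.IsZeroSumFree ∧ S.crossNumber = kStar p a := by
  classical
  set g : ι → G := fun i => e.symm (Pi.single i 1) with hg
  have hord : ∀ i, addOrderOf (g i) = p i ^ a i := fun i => by
    rw [hg, AddEquiv.addOrderOf_eq]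
    exact addOrderOf_single_one (fun j => p j ^ a j) i
  have hne : ∀ i, a i ≠ 0 → g i ≠ 0 := by
    intro i hi h
    have := hord i
    rw [h, addOrderOf_zero] at this
    exact (Nat.one_lt_pow hi (hp i).one_lt).ne this
  -- Indices with `a i = 0` give trivial factors and `g i = 0`; they are excluded from the sequence.
  have hinj : ∀ i j, a i ≠ 0 → g i = g j → i = j := by
    intro i j hi h
    by_contra hij
    have h1 := congrFun (e.symm.injective h) i
    rw [Pi.single_eq_same, Pi.single_eq_of_ne hij] at h1
    have h2 := ZMod.addOrderOf_one (p i ^ a i)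
    rw [h1, addOrderOf_zero] at h2
    exact (Nat.one_lt_pow hi (hp i).one_lt).ne h2
  set E : (Σ _ : {i // a i ≠ 0}, ℕ) ↪ {x : G // x ≠ 0} × ℕ :=
    ⟨fun x => (⟨g x.1, hne x.1 x.1.2⟩, x.2), by
      rintro ⟨i, n⟩ ⟨j, m⟩ h
      obtain ⟨h1, h2⟩ := Prod.ext_iff.1 h
      have h3 : i = j := Subtype.ext (hinj i j i.2 (Subtype.ext_iff.1 h1))
      subst h3
      cases h2
      rfl⟩ with hE
  set S : IndexedSeq G :=
    ((univ : Finset {i // a i ≠ 0}).sigma fun i => range (p i ^ a i - 1)).map E with hS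
  have hSmem : ∀ x ∈ S, ∃ i, a i ≠ 0 ∧ (x.1 : G) = g i ∧ x.2 < p i ^ a i - 1 := by
    intro x hx
    obtain ⟨⟨i, n⟩, hy, rfl⟩ := mem_map.1 hx
    exact ⟨i, i.2, rfl, mem_range.1 (mem_sigma.1 hy).2⟩
  refine ⟨S, ?_, ?_⟩
  · intro T hT hTne h0
    obtain ⟨x, hx⟩ := nonempty_iff_ne_empty.2 hTne
    obtain ⟨i, hi, hxi, -⟩ := hSmem x (hT hx)
    -- The `i`-th coordinate of the sum of `T` counts the copies of `g i` in `T`. Their number is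
    -- positive and at most `p i ^ a i - 1`, so it cannot vanish modulo `p i ^ a i`.
    have h1 : ((#(T.filter fun y => (y.1 : G) = g i) : ℕ) : ZMod (p i ^ a i)) = 0 := by
      have h2 := congrFun (congrArg e h0) i
      rw [IndexedSeq.sum, map_sum, Finset.sum_apply, map_zero, Pi.zero_apply] at h2
      rw [card_filter, Nat.cast_sum, ← h2]
      refine sum_congr rfl fun y hy => ?_
      obtain ⟨j, hj, hyj, -⟩ := hSmem y (hT hy)
      rw [hyj, hg, AddEquiv.apply_symm_apply]
      by_cases hij : j = i
      · subst hij
        simp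
      · rw [if_neg, Pi.single_eq_of_ne' hij, Nat.cast_zero]
        exact fun h => hij (hinj j i hj h)
    rw [ZMod.natCast_eq_zero_iff] at h1
    have h3 : 0 < #(T.filter fun y => (y.1 : G) = g i) :=
      card_pos.2 ⟨x, mem_filter.2 ⟨hx, hxi⟩⟩
    have h4 : #(T.filter fun y => (y.1 : G) = g i) ≤ #(range (p i ^ a i - 1)) := by
      refine card_le_card_of_injOn (fun y => y.2) ?_ ?_
      · intro y hy
        obtain ⟨hy1, hy2⟩ := mem_filter.1 (mem_coe.1 hy)
        obtain ⟨j, hj, hyj, hlt⟩ := hSmem y (hT hy1)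
        obtain rfl := hinj j i hj (hyj.symm.trans hy2)
        exact mem_coe.2 (mem_range.2 hlt)
      · intro y hy z hz hyz
        have hy2 := (mem_filter.1 (mem_coe.1 hy)).2
        have hz2 := (mem_filter.1 (mem_coe.1 hz)).2
        exact Prod.ext (Subtype.ext (hy2.trans hz2.symm)) hyz
    rw [card_range] at h4
    have := Nat.le_of_dvd h3 h1
    omega
  · rw [IndexedSeq.crossNumber, hS, sum_map, sum_sigma, kStar]
    have h1 : ∀ i : {i // a i ≠ 0}, ∑ n ∈ range (p i ^ a i - 1),
        1 / (addOrderOf ((E ⟨i, n⟩).1 : G) : ℚ) = 1 - 1 / (p i : ℚ) ^ a i := by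
      intro i
      have h0 : (p i : ℚ) ^ a i ≠ 0 := pow_ne_zero _ (by exact_mod_cast (hp i).ne_zero)
      rw [sum_congr rfl fun n _ => by
        rw [show ((E ⟨i, n⟩).1 : G) = g i from rfl, hord i], sum_const, card_range, nsmul_eq_mul,
        Nat.cast_sub (Nat.one_le_pow _ _ (hp i).pos)]
      push_cast
      field_simp
    rw [sum_congr rfl fun i _ => h1 i,
      ← sum_subtype (univ.filter fun i => a i ≠ 0) (by simp) fun i => 1 - 1 / (p i : ℚ) ^ a i]
    refine sum_filter_of_ne fun i _ hi h0 => hi ?_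
    simp [h0]

end Sequences

end CrossNumber

theorem mainTheorem4 (G : Type*) [AddCommGroup G] [Finite G]
    (hwide : Wide (AddMonoid.exponent G))
    (hcyc : ∀ (p : ℕ) [Fact p.Prime], p ≠ largestPrimeFactor (AddMonoid.exponent G) →
      IsAddCyclic (AddCommGroup.primaryComponent G p))
    {ι : Type*} [Fintype ι] (p a : ι → ℕ) (hp : ∀ i, (p i).Prime)
    (e : G ≃+ DirectSum ι fun i => ZMod (p i ^ a i)) :
    IsLittleCrossNumber G (kStar p a) := by
  classical
  set e' : G ≃+ ∀ j, ZMod (p j ^ a j) := e.trans (DirectSum.addEquivProd _)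
  refine ⟨CrossNumber.exists_crossNumber_eq_kStar hp e', ?_⟩
  rintro _ ⟨S, hS, rfl⟩
  refine CrossNumber.crossNumber_le_of_crossBound hS (CrossNumber.CrossBound.of_injective
    (CrossNumber.crossBound_pi_zmod hp AddMonoid.exponent_ne_zero_of_finite hwide ?_ ?_)
    e'.toAddMonoidHom e'.injective)
  · intro j
    have h := AddMonoid.addOrder_dvd_exponent (e'.symm (Pi.single j 1))
    rw [AddEquiv.addOrderOf_eq] at h
    exact (CrossNumber.addOrderOf_single_one (fun j => p j ^ a j) j) ▸ h
  · intro P hP hl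
    have : Fact P.Prime := ⟨hP⟩
    have := hcyc P hl
    exact CrossNumber.smallTorsion_of_injective
      (e'.symm.toAddMonoidHom.comp (CrossNumber.Part.extend p a (· = P)))
      (e'.symm.injective.comp (CrossNumber.Part.extend_injective _))
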